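/- **Setting.** Let $n\ge 2$ and $K\in\{0,-1\}$. Put $v_L=-\infty$, $\eta(s)=e^{s}$, $\xi(s)=e^{2s}$ if $K=0$, and $v_L=0$, $\eta(s)=\cosh s$, $\xi(s)=\sinh s$ if $K=-1$. Let $\Omega\subset\mathbb S^n$ be a smooth domain (open, connected, non-empty, with smooth boundary, lying locally on one side of it), let $\sigma$ be the round metric and $\nabla'$ its Levi-Civita connection. Let $\Gamma_n^+=\{\lambda\in\mathbb R^n:\lambda_i>0\ \forall i\}$, and let $f$ be a smooth symmetric function on $\Gamma_n^+$ with $\partial f/\partial\lambda_i>0$ for all $i$, concave and positive on $\Gamma_n^+$, and extending continuously to $\overline{\Gamma_n^+}$ with $f=0$ on $\partial\Gamma_n^+$. For a function $v\in C^2(\overline\Omega)$ with values in $(v_L,\infty)$ put, in a local orthonormal frame of $\mathbb S^n$, $$a_{ij}[v]=\frac1w\Big(\eta(v)\,\delta_{ij}+\eta'(v)\,\tilde\gamma^{ik}\,\nabla'_{kl}v\,\tilde\gamma^{lj}\Big),\qquad w=\sqrt{1+|\nabla' v|^2},\qquad \tilde\gamma^{ik}=\delta_{ik}-\frac{v_iv_k}{w(1+w)},$$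 and $\mathcal G[v]=f(\lambda(a_{ij}[v]))$, where $\lambda$ denotes the vector of eigenvalues (the principal curvatures of the radial graph over $\Omega$ in $\mathbb R^{n+1}$, resp. $\mathbb H^{n+1}$, represented by $v$). The function $v$ is called strictly locally convex if $\{a_{ij}[v]\}$ is positive definite in $\Omega$. Let $\psi$ be a smooth positive function on $\mathbb S^n\times(v_L,\infty)$. Let $\underline v\in C^2(\overline\Omega)$ be strictly locally convex, with $\underline v>v_L$ on $\overline\Omega$ and $$\mathcal G[\underline v]\ge\psi(z,\underline v)\quad\text{in }\Omega,$$ and assume that $\underline v$ is not a solution, i.e. equality does not hold everywhere in $\Omega$. Let $\epsilon>0$ be such that $\mathcal G[\underline v]>\epsilon\,\xi(\underline v)$ in $\Omega$. For $t\in[0,1]$ consider the Dirichlet problem $$\mathcal G[v]=t\,\psi(z,v)+(1-t)\,\epsilon\,\xi(v)\quad\text{in }\Omega,\qquad v=\underline v\quad\text{on }\partial\Omega. \tag{$*$}$$ **Lemma.** Let $t\in[0,1]$ and let $v\in C^2(\overline\Omega)$ be a strictly locally convex solution of $(*)$ with $v\ge\underline v$ in $\Omega$. Then $$v>\underline v\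 \text{ in }\Omega\qquad\text{and}\qquad \mathbf n(v-\underline v)>0\ \text{ on }\partial\Omega,$$ where $\mathbf n$ is the interior unit normal to $\partial\Omega$. (This includes $t=1$, where $\underline v$ is only a non-strict subsolution of $(*)$.) -/

import Mathlib

open scoped Manifold ContDiff Matrix

namespace RadialGraph

/-- The unit sphere of `ℝⁿ⁺¹`, with the topology and the smooth structure of Mathlib. -/
abbrev Sph (n : ℕ) : Type := Metric.sphere (0 : EuclideanSpace ℝ (Fin (n + 1))) 1

noncomputable section

/-! ### Calculus on the round sphere -/

/-- The extension of a function on the sphere to `ℝⁿ⁺¹ ∖ {0}` that is constant along rays: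
`x ↦ v (x / |x|)` (with the irrelevant value `0` at the origin). -/
def rayExt {n : ℕ} (v : Sph n → ℝ) (x : EuclideanSpace ℝ (Fin (n + 1))) : ℝ :=
  open Classical in
  if h : x = 0 then 0
  else v ⟨‖x‖⁻¹ • x, by
    rw [mem_sphere_zero_iff_norm, norm_smul, norm_inv, norm_norm,
      inv_mul_cancel₀ (norm_ne_zero_iff.mpr h)]⟩

/-- The gradient `∇'v` at `z` for the round metric, as a vector of `ℝⁿ⁺¹`. The extension is
constant along rays, so its Euclidean gradient at `z` is tangent to the sphere. -/
def grad {n : ℕ} (v : Sph n → ℝ) (z : Sph n) : EuclideanSpace ℝ (Fin (n + 1)) :=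
  gradient (rayExt v) (z : EuclideanSpace ℝ (Fin (n + 1)))

/-- The covariant Hessian `∇'²v` at `z` for the round metric, on vectors `X, Y ⟂ z`. The
Levi-Civita connection of the sphere is the tangential part of the Euclidean derivative, and
on the sphere `grad v` is the Euclidean gradient of the extension, so that
`∇'²v (X, Y) = ⟨D_X (grad v), Y⟩` is the second derivative of the extension. -/
def hess {n : ℕ} (v : Sph n → ℝ) (z : Sph n) (X Y : EuclideanSpace ℝ (Fin (n + 1))) : ℝ :=
  fderiv ℝ (fderiv ℝ (rayExt v)) (z : EuclideanSpace ℝ (Fin (n + 1))) X Y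

/-- An orthonormal frame `e₁, …, eₙ` of the tangent space `z^⟂` of the sphere at `z`. (The
quantities below that use it are symmetric functions of eigenvalues, or positive
definiteness, and do not depend on which orthonormal frame is taken.) -/
def frame {n : ℕ} (z : Sph n) (i : Fin n) : EuclideanSpace ℝ (Fin (n + 1)) :=
  haveI := Fact.mk (finrank_euclideanSpace_fin (𝕜 := ℝ) (n := n + 1))
  OrthonormalBasis.fromOrthogonalSpanSingleton (𝕜 := ℝ) n (ne_zero_of_mem_unit_sphere z) i

/-- The components `v_i` of the gradient in the frame. -/
def gradVec {n : ℕ} (v : Sph n → ℝ) (z : Sph n) : Fin n → ℝ :=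
  fun i => inner ℝ (grad v z) (frame z i)

/-- The components `∇'_{ij} v` of the Hessian in the frame. -/
def hessMat {n : ℕ} (v : Sph n → ℝ) (z : Sph n) : Matrix (Fin n) (Fin n) ℝ :=
  Matrix.of fun i j => hess v z (frame z i) (frame z j)

/-- `v ∈ C²(Ω̄)`: `v` is twice continuously differentiable in a neighbourhood of every point of
the closure of `Ω`. -/
def IsC2OnClosure {n : ℕ} (Ω : Set (Sph n)) (v : Sph n → ℝ) : Prop :=
  ∀ z ∈ closure Ω, ContMDiffAt (𝓡 n) 𝓘(ℝ, ℝ) 2 v z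

/-! ### Smooth domains -/

/-- `d` is a smooth local defining function of `Ω` at the point `z`: near `z` it is smooth and
`Ω` is the set where `d > 0`, while `d z = 0` and `∇'d (z) ≠ 0`. -/
def IsDefiningFunctionAt {n : ℕ} (Ω : Set (Sph n)) (z : Sph n) (d : Sph n → ℝ) : Prop :=
  d z = 0 ∧ grad d z ≠ 0 ∧
    ∃ U : Set (Sph n), IsOpen U ∧ z ∈ U ∧ ContMDiffOn (𝓡 n) 𝓘(ℝ, ℝ) ∞ d U ∧
      ∀ y ∈ U, (y ∈ Ω ↔ 0 < d y)

/-- A smooth domain of the sphere: open, connected (and non-empty), with smooth boundary. -/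
structure IsSmoothDomain {n : ℕ} (Ω : Set (Sph n)) : Prop where
  isOpen : IsOpen Ω
  isConnected : IsConnected Ω
  smooth_boundary : ∀ z ∈ frontier Ω, ∃ d, IsDefiningFunctionAt Ω z d

/-- `ν` is the interior unit normal to `∂Ω` at the boundary point `z`. -/
def IsInteriorUnitNormal {n : ℕ} (Ω : Set (Sph n)) (z : Sph n)
    (ν : EuclideanSpace ℝ (Fin (n + 1))) : Prop :=
  ∃ d, IsDefiningFunctionAt Ω z d ∧ ν = ‖grad d z‖⁻¹ • grad d z

/-! ### Curvature functions -/

/-- The open cone `Γₙ⁺` of vectors with positive entries. -/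
def posCone (n : ℕ) : Set (Fin n → ℝ) := {l | ∀ i, 0 < l i}

/-- A smooth symmetric function on `Γₙ⁺` with the fundamental structure conditions: increasing
in each variable, concave, positive, and extending continuously by zero to `∂Γₙ⁺`. -/
structure IsCurvatureFunction {n : ℕ} (f : (Fin n → ℝ) → ℝ) : Prop where
  smooth : ContDiffOn ℝ ∞ f (posCone n)
  symmetric : ∀ l ∈ posCone n, ∀ s : Equiv.Perm (Fin n), f (l ∘ s) = f l
  partial_pos : ∀ l ∈ posCone n, ∀ i, 0 < fderiv ℝ f l (Pi.single i 1)
  concave : ConcaveOn ℝ (posCone n) f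
  pos : ∀ l ∈ posCone n, 0 < f l
  continuous_closure : ContinuousOn f (closure (posCone n))
  zero_boundary : ∀ l ∈ frontier (posCone n), f l = 0

/-- `F (A) = f (λ (A))` for a symmetric matrix `A`, where `λ (A)` is the vector of eigenvalues
with multiplicity (and `0` if `A` is not symmetric). -/
def spectralFun {n : ℕ} (f : (Fin n → ℝ) → ℝ) (A : Matrix (Fin n) (Fin n) ℝ) : ℝ :=
  open Classical in if h : A.IsHermitian then f h.eigenvalues else 0

/-! ### Radial graphs in Euclidean and hyperbolic space -/

/-- The two ambient space forms: `ℝⁿ⁺¹` (`K = 0`) and `ℍⁿ⁺¹` (`K = -1`). -/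
inductive Ambient : Type
  | euclidean
  | hyperbolic

/-- The range `(v_L, ∞)` of the unknown: `v_L = -∞` if `K = 0` and `v_L = 0` if `K = -1`. -/
def Ambient.range : Ambient → Set ℝ
  | .euclidean => Set.univ
  | .hyperbolic => Set.Ioi 0

/-- `η (v) = e^v` if `K = 0` and `η (v) = cosh v` if `K = -1`. -/
def Ambient.eta : Ambient → ℝ → ℝ
  | .euclidean => Real.exp
  | .hyperbolic => Real.cosh

/-- `ξ (v) = e^{2v}` if `K = 0` and `ξ (v) = sinh v` if `K = -1`. -/
def Ambient.xi : Ambient → ℝ → ℝ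
  | .euclidean => fun s => Real.exp (2 * s)
  | .hyperbolic => Real.sinh

/-- `w = √(1 + |p|²)`. -/
def graphW {n : ℕ} (p : Fin n → ℝ) : ℝ := √(1 + ∑ i, p i ^ 2)

/-- `γ̃^{ik} = δ_{ik} - p_i p_k / (w (1 + w))`. -/
def gammaTilde {n : ℕ} (p : Fin n → ℝ) : Matrix (Fin n) (Fin n) ℝ :=
  Matrix.of fun i k =>
    (if i = k then 1 else 0) - p i * p k / (graphW p * (1 + graphW p))

/-- `A (r, p, s) = w⁻¹ (η (s) δ_{ij} + η' (s) γ̃^{ik} r_{kl} γ̃^{lj})`. -/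
def Ambient.curvMat (K : Ambient) {n : ℕ} (r : Matrix (Fin n) (Fin n) ℝ) (p : Fin n → ℝ)
    (s : ℝ) : Matrix (Fin n) (Fin n) ℝ :=
  (graphW p)⁻¹ •
    (K.eta s • (1 : Matrix (Fin n) (Fin n) ℝ) +
      deriv K.eta s • (gammaTilde p * r * gammaTilde p))

/-- `𝒢 (r, p, s) = F (A (r, p, s))`. -/
def Ambient.G (K : Ambient) {n : ℕ} (f : (Fin n → ℝ) → ℝ) (r : Matrix (Fin n) (Fin n) ℝ)
    (p : Fin n → ℝ) (s : ℝ) : ℝ :=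
  spectralFun f (K.curvMat r p s)

/-- The matrix `A[v] = {a_{ij}}` at `z`, whose eigenvalues are the principal curvatures of the
radial graph represented by `v`. -/
def Ambient.shape (K : Ambient) {n : ℕ} (v : Sph n → ℝ) (z : Sph n) :
    Matrix (Fin n) (Fin n) ℝ :=
  K.curvMat (hessMat v z) (gradVec v z) (v z)

/-- `𝒢 (∇'²v, ∇'v, v) (z)`. -/
def Ambient.curv (K : Ambient) {n : ℕ} (f : (Fin n → ℝ) → ℝ) (v : Sph n → ℝ) (z : Sph n) : ℝ :=
  K.G f (hessMat v z) (gradVec v z) (v z)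

/-- `v` is strictly locally convex in `Ω`: it takes values in the admissible range and all
principal curvatures are positive, that is, `A[v]` is positive definite. -/
def Ambient.StrictlyLocallyConvex (K : Ambient) {n : ℕ} (Ω : Set (Sph n)) (v : Sph n → ℝ) :
    Prop :=
  ∀ z ∈ Ω, v z ∈ K.range ∧ (K.shape v z).PosDef

/-- `ψ (z, s)` is smooth and positive for `z` in the sphere and `s` in the admissible range. -/
def Ambient.IsSmoothPositive (K : Ambient) {n : ℕ} (ψ : Sph n → ℝ → ℝ) : Prop :=
  ContMDiffOn ((𝓡 n).prod 𝓘(ℝ, ℝ)) 𝓘(ℝ, ℝ) ∞ (fun q : Sph n × ℝ => ψ q.1 q.2)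
      (Set.univ ×ˢ K.range) ∧
    ∀ z, ∀ s ∈ K.range, 0 < ψ z s

/-- `v` solves the Dirichlet problem
`𝒢 (∇'²v, ∇'v, v) = t ψ (z, v) + (1 - t) ε ξ (v)` in `Ω`, `v = vsub` on `∂Ω`. -/
def Ambient.SolvesAux (K : Ambient) {n : ℕ} (f : (Fin n → ℝ) → ℝ) (ψ : Sph n → ℝ → ℝ)
    (ε t : ℝ) (Ω : Set (Sph n)) (vsub v : Sph n → ℝ) : Prop :=
  (∀ z ∈ Ω, K.curv f v z = t * ψ z (v z) + (1 - t) * ε * K.xi (v z)) ∧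
    ∀ z ∈ frontier Ω, v z = vsub z

end

end RadialGraph

open RadialGraph

/-!
The two claims are the strong maximum principle and Hopf's boundary point lemma for the difference
of a solution `v` and a subsolution `vsub` of the equation `𝒢[v] = t ψ + (1 - t) ε ξ`. Both come from
one barrier argument, `Ambient.inner_grad_sub_pos`, at a point `z` of the closure of `Ω` where the
functions agree. It is applied to the nonlinear operator directly; no linearization along a path
from `vsub` to `v` is formed, and the spectral function `F (A) = f (λ (A))` is never differentiated.

Let `φ` vanish at `z` with `grad φ z ≠ 0`, and suppose that `v > vsub` where `φ ≥ 0` near `z`, except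
at `z`. If `v - vsub - τ (exp (α φ) - 1)` had a negative minimum in `{φ ≥ 0}` near `z`, then at that
point the Hessian of `v` would exceed that of `vsub` by at least `E (α² ∇φ ⊗ ∇φ + α ∇²φ)`, with
`E = τ exp (α φ)`, while the gradients differ by `E α ∇φ` and the values by at most `E`. The
term of order `E α²` raises the curvature, the others change it by `O (E α)`, so for `α` large
`𝒢[v] - 𝒢[vsub]` exceeds any given multiple of `E` (`Ambient.exists_barrier_constants`). This
contradicts the equation, whose right-hand side is Lipschitz in `v`
(`Ambient.SolvesAux.eventually_curv_le`). Hence `v - vsub` lies above the barrier and has positive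
derivative along `grad φ z`.

The ellipticity of `F` that is used is `IsCurvatureFunction.exists_spectral_gain`: Weyl's inequality
compares the eigenvalues one by one, their sum is the trace, and `f` has partial derivatives between
positive constants on compact boxes in the cone. The curvature matrix of `vsub` is only assumed
positive definite inside `Ω`; it is uniformly so up to the boundary because its eigenvalues are
bounded, `f` of them is at least `ψ > 0`, and `f` vanishes on the boundary of the cone
(`IsCurvatureFunction.exists_lower_bound`). As every estimate holds for all orthonormal frames at
once, no continuity of the frame in the point is required.

In the interior the barrier argument shows that `v = vsub` at one point of `Ω` forces `v = vsub`
throughout (`IsSmoothDomain.dichotomy`). Then `vsub` solves the equation, which is excluded for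
`t < 1` by the strict inequality for `ε ξ` and for `t = 1` by assumption. On the boundary the
barrier is built from a defining function of `Ω`.
-/

namespace RadialGraph

open Filter Topology

/-! ### Eigenvalues of symmetric matrices -/

theorem dotProduct_mulVec_eq_sum_eigenvalues {n : ℕ} {A : Matrix (Fin n) (Fin n) ℝ}
    (hA : A.IsHermitian) (x : Fin n → ℝ) :
    x ⬝ᵥ A *ᵥ x = ∑ j, hA.eigenvalues j * ((hA.eigenvectorBasis j).ofLp ⬝ᵥ x) ^ 2 := by
  have h := hA.eigenvectorBasis.sum_inner_mul_inner (WithLp.toLp 2 x) (WithLp.toLp 2 (A *ᵥ x))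
  simp only [EuclideanSpace.inner_eq_star_dotProduct, star_trivial] at h
  rw [dotProduct_comm x, ← h]
  refine Finset.sum_congr rfl fun j _ => ?_
  have h2 : A *ᵥ x ⬝ᵥ (hA.eigenvectorBasis j).ofLp
      = hA.eigenvalues j * ((hA.eigenvectorBasis j).ofLp ⬝ᵥ x) := by
    have hT : Aᵀ = A := by simpa [Matrix.IsHermitian] using hA
    rw [dotProduct_comm, Matrix.dotProduct_mulVec, ← Matrix.mulVec_transpose, hT,
      hA.mulVec_eigenvectorBasis]
    simp [smul_dotProduct]
  rw [h2]; ring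

theorem dotProduct_self_eq_sum_eigenvectorBasis {n : ℕ} {A : Matrix (Fin n) (Fin n) ℝ}
    (hA : A.IsHermitian) (x : Fin n → ℝ) :
    x ⬝ᵥ x = ∑ j, ((hA.eigenvectorBasis j).ofLp ⬝ᵥ x) ^ 2 := by
  have h := hA.eigenvectorBasis.sum_inner_mul_inner (WithLp.toLp 2 x) (WithLp.toLp 2 x)
  simp only [EuclideanSpace.inner_eq_star_dotProduct, star_trivial] at h
  rw [← h]
  refine Finset.sum_congr rfl fun j _ => ?_
  rw [dotProduct_comm x]; ring

/-- Weyl's inequality. Mathlib indexes the eigenvalues of every matrix of a given size through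
one fixed enumeration, along which they decrease, so that the comparison holds index by index.
A vector orthogonal to the eigenvectors of `A` after `i` and to those of `B` before `i` exists
by a dimension count. -/
theorem eigenvalues_le_eigenvalues_add {n : ℕ} {A B : Matrix (Fin n) (Fin n) ℝ}
    (hA : A.IsHermitian) (hB : B.IsHermitian) {c : ℝ}
    (h : ∀ x : Fin n → ℝ, x ⬝ᵥ A *ᵥ x ≤ x ⬝ᵥ B *ᵥ x + c * (x ⬝ᵥ x)) (i : Fin n) :
    hA.eigenvalues i ≤ hB.eigenvalues i + c := by
  obtain ⟨e, he⟩ : ∃ e : Fin n → Fin (Fintype.card (Fin n)), Function.Injective e ∧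
      ∀ {C : Matrix (Fin n) (Fin n) ℝ} (hC : C.IsHermitian) (j k : Fin n), e j ≤ e k →
        hC.eigenvalues k ≤ hC.eigenvalues j :=
    ⟨(Fintype.equivOfCardEq (Fintype.card_fin _)).symm, Equiv.injective _,
      fun hC j k hjk => hC.eigenvalues₀_antitone hjk⟩
  obtain ⟨he_inj, he_anti⟩ := he
  let L : (Fin n → ℝ) →ₗ[ℝ] ({j : Fin n // j ≠ i} → ℝ) :=
    LinearMap.pi fun j => if e i < e j.1
      then dotProductBilin ℝ ℝ (hA.eigenvectorBasis j.1).ofLp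
      else dotProductBilin ℝ ℝ (hB.eigenvectorBasis j.1).ofLp
  have hker : L.ker ≠ ⊥ := by
    apply LinearMap.ker_ne_bot_of_finrank_lt
    rw [Module.finrank_fintype_fun_eq_card, Module.finrank_fintype_fun_eq_card]
    simpa using i.pos
  obtain ⟨x, hx, hx0⟩ := (Submodule.ne_bot_iff _).1 hker
  have hL : ∀ j : Fin n, j ≠ i → (if e i < e j then (hA.eigenvectorBasis j).ofLp ⬝ᵥ x
      else (hB.eigenvectorBasis j).ofLp ⬝ᵥ x) = 0 := by
    intro j hj
    have := congrFun (LinearMap.mem_ker.1 hx) ⟨j, hj⟩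
    simp only [L, LinearMap.pi_apply] at this
    split_ifs with hc <;> simpa [hc] using this
  have hpos : 0 < x ⬝ᵥ x := by
    have := Matrix.dotProduct_star_self_pos_iff (v := x)
    simpa using this.2 hx0
  have h1 : hA.eigenvalues i * (x ⬝ᵥ x) ≤ x ⬝ᵥ A *ᵥ x := by
    rw [dotProduct_mulVec_eq_sum_eigenvalues hA, dotProduct_self_eq_sum_eigenvectorBasis hA,
      Finset.mul_sum]
    refine Finset.sum_le_sum fun j _ => ?_
    rcases lt_or_ge (e i) (e j) with hc | hc
    · have := hL j (by rintro rfl; exact lt_irrefl _ hc)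
      rw [if_pos hc] at this
      simp [this]
    · exact mul_le_mul_of_nonneg_right (he_anti hA _ _ hc) (sq_nonneg _)
  have h2 : x ⬝ᵥ B *ᵥ x ≤ hB.eigenvalues i * (x ⬝ᵥ x) := by
    rw [dotProduct_mulVec_eq_sum_eigenvalues hB, dotProduct_self_eq_sum_eigenvectorBasis hB,
      Finset.mul_sum]
    refine Finset.sum_le_sum fun j _ => ?_
    rcases lt_or_ge (e j) (e i) with hc | hc
    · have := hL j (by rintro rfl; exact lt_irrefl _ hc)
      rw [if_neg hc.not_gt] at this
      simp [this]
    · exact mul_le_mul_of_nonneg_right (he_anti hB _ _ hc) (sq_nonneg _)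
  have h3 := h x
  by_contra hlt
  push Not at hlt
  nlinarith

theorem sum_eigenvalues_eq_sum_diag {n : ℕ} {A : Matrix (Fin n) (Fin n) ℝ}
    (hA : A.IsHermitian) : ∑ i, hA.eigenvalues i = ∑ i, A i i := by
  simpa [Matrix.trace] using hA.trace_eq_sum_eigenvalues.symm

theorem single_dotProduct_mulVec_single {n : ℕ} (A : Matrix (Fin n) (Fin n) ℝ) (i : Fin n) :
    (Pi.single i 1 : Fin n → ℝ) ⬝ᵥ A *ᵥ Pi.single i 1 = A i i := by
  simp

/-! ### Curvature functions on boxes and on spectra -/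

theorem isOpen_posCone (n : ℕ) : IsOpen (posCone n) := by
  have : posCone n = Set.univ.pi fun _ => Set.Ioi (0 : ℝ) := by
    ext l; simp [posCone]
  rw [this]
  exact isOpen_set_pi Set.finite_univ fun _ _ => isOpen_Ioi

theorem convex_posCone (n : ℕ) : Convex ℝ (posCone n) := by
  have : posCone n = Set.univ.pi fun _ => Set.Ioi (0 : ℝ) := by
    ext l; simp [posCone]
  rw [this]
  exact convex_pi fun _ _ => convex_Ioi 0

theorem closure_posCone (n : ℕ) : closure (posCone n) = {l | ∀ i, 0 ≤ l i} := by
  have : posCone n = Set.univ.pi fun _ => Set.Ioi (0 : ℝ) := by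
    ext l; simp [posCone]
  rw [this, closure_pi_set]
  ext l; simp [Pi.le_def]

/-- The derivative of `f` in the direction `y - x` is the sum of its partial derivatives with
weights `y i - x i`, and the increment of `f` is such a derivative at a point between. -/
theorem IsCurvatureFunction.exists_sub_eq_sum {n : ℕ} {f : (Fin n → ℝ) → ℝ}
    (hf : IsCurvatureFunction f) {x y : Fin n → ℝ} (hx : x ∈ posCone n) (hy : y ∈ posCone n) :
    ∃ z ∈ segment ℝ x y, f y - f x = ∑ i, (y i - x i) * fderiv ℝ f z (Pi.single i 1) := by
  have hd : ∀ z ∈ posCone n, HasFDerivWithinAt f (fderiv ℝ f z) (posCone n) z := fun z hz =>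
    (((hf.smooth.contDiffAt ((isOpen_posCone n).mem_nhds hz)).differentiableAt
      (by simp)).hasFDerivAt).hasFDerivWithinAt
  obtain ⟨z, hz, h⟩ := domain_mvt hd (convex_posCone n) hx hy
  refine ⟨z, hz, ?_⟩
  rw [h]
  conv_lhs => rw [← Finset.univ_sum_single (y - x)]
  rw [map_sum]
  refine Finset.sum_congr rfl fun i _ => ?_
  rw [show (Pi.single i ((y - x) i) : Fin n → ℝ) = (y i - x i) • Pi.single i 1 by
    rw [← Pi.single_smul]; simp, map_smul, smul_eq_mul]

theorem IsCurvatureFunction.mono {n : ℕ} {f : (Fin n → ℝ) → ℝ}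
    (hf : IsCurvatureFunction f) {x y : Fin n → ℝ} (hx : x ∈ posCone n) (hxy : ∀ i, x i ≤ y i) :
    f x ≤ f y := by
  have hy : y ∈ posCone n := fun i => (hx i).trans_le (hxy i)
  obtain ⟨z, hz, h⟩ := hf.exists_sub_eq_sum hx hy
  have hz' := (convex_posCone n).segment_subset hx hy hz
  have : 0 ≤ f y - f x := by
    rw [h]
    exact Finset.sum_nonneg fun i _ =>
      mul_nonneg (sub_nonneg.2 (hxy i)) (hf.partial_pos z hz' i).le
  linarith

/-- On a compact box inside the positive cone the partial derivatives lie between two positive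
constants. -/
theorem IsCurvatureFunction.exists_increment_bounds {n : ℕ} {f : (Fin n → ℝ) → ℝ}
    (hf : IsCurvatureFunction f) {m M : ℝ} (hm : 0 < m) :
    ∃ c > 0, ∃ C > 0, ∀ x y : Fin n → ℝ, (∀ i, m ≤ x i) → (∀ i, x i ≤ y i) → (∀ i, y i ≤ M) →
      c * ∑ i, (y i - x i) ≤ f y - f x ∧ f y - f x ≤ C * ∑ i, (y i - x i) := by
  let B : Set (Fin n → ℝ) := Set.Icc (fun _ => m) (fun _ => M)
  have hB : IsCompact B := isCompact_Icc
  have hBpos : B ⊆ posCone n := fun l hl i => hm.trans_le (hl.1 i)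
  have hcont : ∀ i : Fin n, ContinuousOn (fun l => fderiv ℝ f l (Pi.single i 1)) B := fun i =>
    ((hf.smooth.continuousOn_fderiv_of_isOpen (isOpen_posCone n) (by simp)).mono
      hBpos).clm_apply continuousOn_const
  have h1 : ∀ i : Fin n, ∃ c > 0, ∃ C > 0, ∀ l ∈ B, c ≤ fderiv ℝ f l (Pi.single i 1) ∧
      fderiv ℝ f l (Pi.single i 1) ≤ C := by
    intro i
    rcases B.eq_empty_or_nonempty with he | hne
    · exact ⟨1, one_pos, 1, one_pos, by simp [he]⟩
    obtain ⟨a, ha, ha'⟩ := hB.exists_isMinOn hne (hcont i)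
    obtain ⟨b, hb, hb'⟩ := hB.exists_isMaxOn hne (hcont i)
    exact ⟨_, hf.partial_pos a (hBpos ha) i, _, hf.partial_pos b (hBpos hb) i,
      fun l hl => ⟨ha' hl, hb' hl⟩⟩
  choose c hc C hC hcC using h1
  obtain ⟨c0, hc0, hc0'⟩ : ∃ c0 > 0, ∀ i, c0 ≤ c i := by
    rcases isEmpty_or_nonempty (Fin n) with he | hne
    · exact ⟨1, one_pos, fun i => he.elim i⟩
    · obtain ⟨i, hi⟩ := Finite.exists_min c
      exact ⟨c i, hc i, hi⟩
  obtain ⟨C0, hC0, hC0'⟩ : ∃ C0 > 0, ∀ i, C i ≤ C0 := by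
    rcases isEmpty_or_nonempty (Fin n) with he | hne
    · exact ⟨1, one_pos, fun i => he.elim i⟩
    · obtain ⟨i, hi⟩ := Finite.exists_max C
      exact ⟨C i, hC i, hi⟩
  refine ⟨c0, hc0, C0, hC0, fun x y hx hxy hy => ?_⟩
  have hxB : x ∈ B := ⟨hx, fun i => (hxy i).trans (hy i)⟩
  have hyB : y ∈ B := ⟨fun i => (hx i).trans (hxy i), hy⟩
  obtain ⟨z, hz, h⟩ := hf.exists_sub_eq_sum (hBpos hxB) (hBpos hyB)
  have hzB : z ∈ B := (convex_Icc _ _).segment_subset hxB hyB hz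
  rw [h, Finset.mul_sum, Finset.mul_sum]
  constructor <;> refine Finset.sum_le_sum fun i _ => ?_
  · rw [mul_comm]
    exact mul_le_mul_of_nonneg_left ((hc0' i).trans (hcC i z hzB).1) (sub_nonneg.2 (hxy i))
  · rw [mul_comm C0]
    exact mul_le_mul_of_nonneg_left ((hcC i z hzB).2.trans (hC0' i)) (sub_nonneg.2 (hxy i))

/-- A bounded set of spectra on which `f` stays away from zero stays away from the boundary of
the cone, because `f` vanishes there. -/
theorem IsCurvatureFunction.exists_lower_bound {n : ℕ} {f : (Fin n → ℝ) → ℝ}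
    (hf : IsCurvatureFunction f) {c M : ℝ} (hc : 0 < c) :
    ∃ m > 0, ∀ l ∈ posCone n, (∀ i, l i ≤ M) → c ≤ f l → ∀ i, m ≤ l i := by
  let B : Set (Fin n → ℝ) := Set.Icc 0 (fun _ => M)
  have hBcl : B ⊆ closure (posCone n) := fun l hl => by
    rw [closure_posCone]; exact fun i => hl.1 i
  let S : Set (Fin n → ℝ) := B ∩ f ⁻¹' Set.Ici c
  have hS : IsCompact S := isCompact_Icc.of_isClosed_subset
    ((hf.continuous_closure.mono hBcl).preimage_isClosed_of_isClosed isClosed_Icc isClosed_Ici)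
    Set.inter_subset_left
  have hSpos : S ⊆ posCone n := by
    intro l hl
    by_contra hn
    have : f l = 0 := hf.zero_boundary l ⟨hBcl hl.1, by rwa [(isOpen_posCone n).interior_eq]⟩
    have h2 : c ≤ f l := hl.2
    linarith
  have h1 : ∀ i : Fin n, ∃ m > 0, ∀ l ∈ S, m ≤ l i := by
    intro i
    rcases S.eq_empty_or_nonempty with he | hne
    · exact ⟨1, one_pos, by simp [he]⟩
    obtain ⟨a, ha, ha'⟩ := hS.exists_isMinOn hne (continuous_apply i).continuousOn
    exact ⟨_, hSpos ha i, fun l hl => ha' hl⟩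
  choose m hm hmS using h1
  have h2 : ∃ c0 > 0, ∀ i, c0 ≤ m i := by
    rcases isEmpty_or_nonempty (Fin n) with he | hne
    · exact ⟨1, one_pos, fun i => he.elim i⟩
    · obtain ⟨i, hi⟩ := Finite.exists_min m
      exact ⟨m i, hm i, hi⟩
  obtain ⟨c0, hc0, hc0'⟩ := h2
  exact ⟨c0, hc0, fun l hl hlM hcl i =>
    (hc0' i).trans (hmS i l ⟨⟨fun j => (hl j).le, hlM⟩, hcl⟩)⟩

theorem spectralFun_of_isHermitian {n : ℕ} (f : (Fin n → ℝ) → ℝ)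
    {A : Matrix (Fin n) (Fin n) ℝ} (hA : A.IsHermitian) : spectralFun f A = f hA.eigenvalues := by
  exact dif_pos hA

/-- Uniform ellipticity of `F (A) = f (λ (A))` on the matrices `A` with spectrum in `[m, M]`,
without differentiating `F`. If `B ≥ A + κ b ⊗ b - δ` then `F` gains from the trace of the rank one
term and loses at most linearly in `δ`; no upper bound on `B` is required. -/
theorem IsCurvatureFunction.exists_spectral_gain {n : ℕ} {f : (Fin n → ℝ) → ℝ}
    (hf : IsCurvatureFunction f) {m M : ℝ} (hm : 0 < m) :
    ∃ c > 0, ∃ C > 0, ∀ (A B : Matrix (Fin n) (Fin n) ℝ) (hA : A.IsHermitian) (_ : B.PosDef)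
      (b : Fin n → ℝ) (κ δ : ℝ), (∀ i, m ≤ hA.eigenvalues i) → (∀ i, hA.eigenvalues i ≤ M) →
      0 ≤ δ → δ ≤ m / 2 → 0 ≤ κ → κ * (b ⬝ᵥ b) ≤ 1 →
      (∀ x : Fin n → ℝ, x ⬝ᵥ A *ᵥ x + κ * (b ⬝ᵥ x) ^ 2 - δ * (x ⬝ᵥ x) ≤ x ⬝ᵥ B *ᵥ x) →
      c * (κ * (b ⬝ᵥ b)) - C * δ ≤ spectralFun f B - spectralFun f A := by
  obtain ⟨c, hc, C, hC, hcC⟩ := hf.exists_increment_bounds (m := m / 2) (M := M + 1) (half_pos hm)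
  refine ⟨c, hc, C * n + 1, by positivity, ?_⟩
  intro A B hA hB b κ δ hAm hAM hδ hδm hκ hκ1 h
  have hBh := hB.isHermitian
  rw [spectralFun_of_isHermitian f hA, spectralFun_of_isHermitian f hBh]
  set l := hA.eigenvalues
  set μ := hBh.eigenvalues
  have hle : ∀ i, l i - δ ≤ μ i := by
    intro i
    have := eigenvalues_le_eigenvalues_add hA hBh (c := δ) (fun x => by
      have : 0 ≤ κ * (b ⬝ᵥ x) ^ 2 := by positivity
      linarith [h x]) i
    linarith
  have htr : ∑ i, (l i - δ) + κ * (b ⬝ᵥ b) ≤ ∑ i, μ i := by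
    rw [Finset.sum_sub_distrib, sum_eigenvalues_eq_sum_diag hA, sum_eigenvalues_eq_sum_diag hBh,
      dotProduct, Finset.mul_sum, ← Finset.sum_sub_distrib, ← Finset.sum_add_distrib]
    refine Finset.sum_le_sum fun i _ => ?_
    have := h (Pi.single i 1)
    rw [single_dotProduct_mulVec_single, single_dotProduct_mulVec_single] at this
    simp at this
    nlinarith
  set T := κ * (b ⬝ᵥ b)
  have hT0 : 0 ≤ T := by
    have : 0 ≤ b ⬝ᵥ b := Finset.sum_nonneg fun i _ => mul_self_nonneg (b i)
    positivity
  set D := ∑ i, (μ i - (l i - δ)) with hD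
  have hTD : T ≤ D := by rw [hD, Finset.sum_sub_distrib]; linarith
  -- move from `l - δ` towards `μ` only as far as the trace `T` requires
  obtain ⟨θ, hθ0, hθ1, hθ⟩ : ∃ θ : ℝ, 0 ≤ θ ∧ θ ≤ 1 ∧ θ * D = T := by
    rcases eq_or_lt_of_le (hT0.trans hTD) with h0 | h0
    · exact ⟨0, le_rfl, zero_le_one, by linarith⟩
    · exact ⟨T / D, by positivity, (div_le_one h0).2 hTD, by field_simp⟩
  let ν : Fin n → ℝ := fun i => (l i - δ) + θ * (μ i - (l i - δ))
  have hinc : ∀ i, 0 ≤ θ * (μ i - (l i - δ)) := fun i =>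
    mul_nonneg hθ0 (sub_nonneg.2 (hle i))
  have hsum : ∑ i, θ * (μ i - (l i - δ)) = T := by rw [← Finset.mul_sum]; exact hθ
  have h1 := (hcC (fun i => l i - δ) ν (fun i => by linarith [hAm i])
    (fun i => by simp only [ν]; linarith [hinc i])
    (fun i => by
      have := Finset.single_le_sum (fun j _ => hinc j) (Finset.mem_univ i)
      simp only [ν]; linarith [hAM i])).1
  have h2 := (hcC (fun i => l i - δ) l (fun i => by linarith [hAm i]) (fun i => by linarith)
    (fun i => by linarith [hAM i])).2
  have h3 : f ν ≤ f μ := hf.mono (x := ν)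
    (fun i => by simp only [ν]; linarith [hinc i, hAm i])
    (fun i => by simp only [ν]; nlinarith [hle i])
  have h4 : ∑ i, (ν i - (l i - δ)) = T := by rw [← hsum]; simp [ν]
  have h5 : ∑ i, (l i - (l i - δ)) = n * δ := by simp
  rw [h4] at h1
  rw [h5] at h2
  nlinarith

/-! ### The curvature matrix as a function of the 2-jet -/

theorem graphW_pos {n : ℕ} (p : Fin n → ℝ) : 0 < graphW p :=
  Real.sqrt_pos.2 (by positivity)

theorem contDiff_graphW (n : ℕ) : ContDiff ℝ 1 (graphW : (Fin n → ℝ) → ℝ) := by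
  unfold graphW
  refine ContDiff.sqrt (by fun_prop) fun p => ?_
  positivity

theorem contDiff_gammaTilde {n : ℕ} (i k : Fin n) :
    ContDiff ℝ 1 (fun p : Fin n → ℝ => gammaTilde p i k) := by
  have hW := contDiff_graphW n
  simp only [gammaTilde, Matrix.of_apply]
  refine contDiff_const.sub (ContDiff.div (by fun_prop) (by fun_prop) fun p => ?_)
  have := graphW_pos p
  positivity

theorem gammaTilde_transpose {n : ℕ} (p : Fin n → ℝ) : (gammaTilde p)ᵀ = gammaTilde p := by
  ext i k
  simp only [gammaTilde, Matrix.transpose_apply, Matrix.of_apply, mul_comm (p k), eq_comm (a := k)]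

theorem gammaTilde_mulVec {n : ℕ} (p q : Fin n → ℝ) (i : Fin n) :
    (gammaTilde p *ᵥ q) i = q i - p i * (p ⬝ᵥ q) / (graphW p * (1 + graphW p)) := by
  simp only [Matrix.mulVec, dotProduct, gammaTilde, Matrix.of_apply, sub_mul,
    Finset.sum_sub_distrib, ite_mul, one_mul, zero_mul, Finset.sum_ite_eq, Finset.mem_univ, if_true]
  rw [Finset.mul_sum, Finset.sum_div]
  congr 1
  exact Finset.sum_congr rfl fun j _ => by ring

/-- `γ̃` is injective, since its eigenvalues are `1` and `1 / w`. -/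
theorem gammaTilde_mulVec_eq_zero {n : ℕ} {p q : Fin n → ℝ} (h : gammaTilde p *ᵥ q = 0) :
    q = 0 := by
  have hW := graphW_pos p
  set W := graphW p with hWdef
  have hW2 : W ^ 2 = 1 + p ⬝ᵥ p := by
    rw [hWdef, graphW, Real.sq_sqrt (by positivity)]
    simp [dotProduct, sq]
  have hq : ∀ i, q i = p i * (p ⬝ᵥ q) / (W * (1 + W)) := fun i => by
    have := congrFun h i
    rw [gammaTilde_mulVec] at this
    simpa [sub_eq_zero] using this
  have hpq : p ⬝ᵥ q = (p ⬝ᵥ p) * (p ⬝ᵥ q) / (W * (1 + W)) := by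
    conv_lhs => rw [dotProduct]
    rw [dotProduct, Finset.sum_mul, Finset.sum_div]
    exact Finset.sum_congr rfl fun i _ => by rw [hq i]; ring
  have h0 : p ⬝ᵥ q = 0 := by
    rw [eq_div_iff (by positivity)] at hpq
    have h1 : (p ⬝ᵥ q) * (W + 1) = 0 := by linear_combination hpq - (p ⬝ᵥ q) * hW2
    rcases mul_eq_zero.1 h1 with h | h
    · exact h
    · linarith
  ext i
  rw [hq i, h0]; simp

theorem Ambient.contDiff_eta (K : Ambient) : ContDiff ℝ 1 K.eta := by
  cases K
  · exact Real.contDiff_exp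
  · exact Real.contDiff_cosh

theorem Ambient.contDiff_deriv_eta (K : Ambient) : ContDiff ℝ 1 (deriv K.eta) := by
  cases K
  · simp only [Ambient.eta, Real.deriv_exp]; exact Real.contDiff_exp
  · simp only [Ambient.eta, Real.deriv_cosh]; exact Real.contDiff_sinh

theorem Ambient.deriv_eta_pos (K : Ambient) {s : ℝ} (hs : s ∈ K.range) : 0 < deriv K.eta s := by
  cases K
  · simp only [Ambient.eta, Real.deriv_exp]; exact Real.exp_pos s
  · simp only [Ambient.eta, Real.deriv_cosh]; exact Real.sinh_pos_iff.2 hs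

theorem Ambient.contDiff_xi (K : Ambient) : ContDiff ℝ 1 K.xi := by
  cases K
  · exact Real.contDiff_exp.comp (contDiff_const.mul contDiff_id)
  · exact Real.contDiff_sinh

theorem Ambient.isOpen_range (K : Ambient) : IsOpen K.range := by
  cases K
  · exact isOpen_univ
  · exact isOpen_Ioi

theorem Ambient.contDiff_curvMat (K : Ambient) (n : ℕ) :
    ContDiff ℝ 1 (fun q : (Fin n → Fin n → ℝ) × (Fin n → ℝ) × ℝ =>
      (fun i j => K.curvMat (Matrix.of q.1) q.2.1 q.2.2 i j : Fin n → Fin n → ℝ)) := by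
  rw [contDiff_pi]; intro i
  rw [contDiff_pi]; intro j
  have hW : ContDiff ℝ 1 fun q : (Fin n → Fin n → ℝ) × (Fin n → ℝ) × ℝ => (graphW q.2.1)⁻¹ :=
    ((contDiff_graphW n).comp (by fun_prop)).inv fun q => (graphW_pos _).ne'
  have hγ : ∀ i j, ContDiff ℝ 1 fun q : (Fin n → Fin n → ℝ) × (Fin n → ℝ) × ℝ =>
    gammaTilde q.2.1 i j := fun i j => (contDiff_gammaTilde i j).comp (by fun_prop)
  have he : ContDiff ℝ 1 fun q : (Fin n → Fin n → ℝ) × (Fin n → ℝ) × ℝ => K.eta q.2.2 :=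
    K.contDiff_eta.comp (by fun_prop)
  have he' : ContDiff ℝ 1 fun q : (Fin n → Fin n → ℝ) × (Fin n → ℝ) × ℝ => deriv K.eta q.2.2 :=
    K.contDiff_deriv_eta.comp (by fun_prop)
  simp only [Ambient.curvMat, Matrix.smul_apply, Matrix.add_apply, Matrix.mul_apply, smul_eq_mul,
    Matrix.of_apply]
  refine hW.mul ((he.mul contDiff_const).add (he'.mul (ContDiff.sum fun l _ =>
    (ContDiff.sum fun k _ => (hγ i k).mul ?_).mul (hγ l j))))
  fun_prop

/-- On bounded jets with values in a compact interval the entries of the curvature matrix are bounded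
and Lipschitz in the jet. -/
theorem Ambient.exists_curvMat_bounds (K : Ambient) (n : ℕ) (R a b : ℝ) :
    ∃ L > 0, ∀ (r r' : Matrix (Fin n) (Fin n) ℝ) (p p' : Fin n → ℝ) (s s' d : ℝ),
      (∀ i j, |r i j| ≤ R) → (∀ i j, |r' i j| ≤ R) → (∀ i, |p i| ≤ R) → (∀ i, |p' i| ≤ R) →
      s ∈ Set.Icc a b → s' ∈ Set.Icc a b → 0 ≤ d →
      (∀ i j, |r i j - r' i j| ≤ d) → (∀ i, |p i - p' i| ≤ d) → |s - s'| ≤ d →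
      ∀ i j, |K.curvMat r p s i j| ≤ L ∧
        |K.curvMat r p s i j - K.curvMat r' p' s' i j| ≤ L * d := by
  let Q : Set ((Fin n → Fin n → ℝ) × (Fin n → ℝ) × ℝ) :=
    (Set.univ.pi fun _ => Set.univ.pi fun _ => Set.Icc (-R) R) ×ˢ
      (Set.univ.pi fun _ => Set.Icc (-R) R) ×ˢ Set.Icc a b
  have hQ : IsCompact Q :=
    (isCompact_univ_pi fun _ => isCompact_univ_pi fun _ => isCompact_Icc).prod
      ((isCompact_univ_pi fun _ => isCompact_Icc).prod isCompact_Icc)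
  have hT := K.contDiff_curvMat n
  obtain ⟨L, hL⟩ := LocallyLipschitzOn.exists_lipschitzOnWith_of_compact hQ
    (hT.locallyLipschitz.locallyLipschitzOn (s := Q))
  obtain ⟨C, hC⟩ := hQ.exists_bound_of_continuousOn hT.continuous.continuousOn
  refine ⟨L + |C| + 1, by positivity, ?_⟩
  intro r r' p p' s s' d hr hr' hp hp' hs hs' hd hrd hpd hsd i j
  have hq : ((fun i j => r i j, p, s) : (Fin n → Fin n → ℝ) × (Fin n → ℝ) × ℝ) ∈ Q := by
    simp only [Q, Set.mem_prod, Set.mem_pi, Set.mem_univ, true_imp_iff]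
    exact ⟨fun i j => abs_le.1 (hr i j), fun i => abs_le.1 (hp i), hs⟩
  have hq' : ((fun i j => r' i j, p', s') : (Fin n → Fin n → ℝ) × (Fin n → ℝ) × ℝ) ∈ Q := by
    simp only [Q, Set.mem_prod, Set.mem_pi, Set.mem_univ, true_imp_iff]
    exact ⟨fun i j => abs_le.1 (hr' i j), fun i => abs_le.1 (hp' i), hs'⟩
  constructor
  · have h1 := (norm_le_pi_norm _ j).trans ((norm_le_pi_norm _ i).trans (hC _ hq))
    have h2 : |K.curvMat r p s i j| ≤ C := h1
    have h3 : C ≤ |C| := le_abs_self C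
    have h4 : (0 : ℝ) ≤ L := L.2
    linarith
  · have h1 := hL.dist_le_mul _ hq _ hq'
    have h2 : dist ((fun i j => r i j, p, s) : (Fin n → Fin n → ℝ) × (Fin n → ℝ) × ℝ)
        (fun i j => r' i j, p', s') ≤ d := by
      simp only [Prod.dist_eq]
      refine max_le ((dist_pi_le_iff hd).2 fun i => (dist_pi_le_iff hd).2 fun j => hrd i j)
        (max_le ((dist_pi_le_iff hd).2 fun i => hpd i) hsd)
    have h3 := (dist_le_pi_dist _ _ j).trans ((dist_le_pi_dist _ _ i).trans h1)
    have h4 : |K.curvMat r p s i j - K.curvMat r' p' s' i j| ≤ L *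
      dist ((fun i j => r i j, p, s) : (Fin n → Fin n → ℝ) × (Fin n → ℝ) × ℝ)
        (fun i j => r' i j, p', s') := h3
    refine h4.trans ((mul_le_mul_of_nonneg_left h2 L.2).trans
      (mul_le_mul_of_nonneg_right ?_ hd))
    have := abs_nonneg C
    show (L : ℝ) ≤ _
    linarith

theorem abs_dotProduct_mulVec_le {n : ℕ} {M : Matrix (Fin n) (Fin n) ℝ} {C : ℝ}
    (hM : ∀ i j, |M i j| ≤ C) (x : Fin n → ℝ) : |x ⬝ᵥ M *ᵥ x| ≤ n * C * (x ⬝ᵥ x) := by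
  have h1 : x ⬝ᵥ M *ᵥ x = ∑ i, ∑ j, x i * M i j * x j := by
    simp only [dotProduct, Matrix.mulVec, Finset.mul_sum, mul_assoc]
  have h2 : ∑ i : Fin n, ∑ j : Fin n, C * ((x i * x i + x j * x j) / 2) = n * C * (x ⬝ᵥ x) := by
    simp only [← Finset.mul_sum, ← Finset.sum_div, Finset.sum_add_distrib, Finset.sum_const,
      Finset.card_univ, Fintype.card_fin, nsmul_eq_mul, dotProduct]
    have h3 : ∑ i, x i * (n * x i) = n * ∑ i, x i * x i := by
      rw [Finset.mul_sum]
      exact Finset.sum_congr rfl fun i _ => by ring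
    rw [h3]
    ring
  rw [h1, ← h2]
  refine (Finset.abs_sum_le_sum_abs _ _).trans (Finset.sum_le_sum fun i _ =>
    (Finset.abs_sum_le_sum_abs _ _).trans (Finset.sum_le_sum fun j _ => ?_))
  rw [abs_mul, abs_mul]
  have hC : 0 ≤ C := (abs_nonneg _).trans (hM i j)
  have h3 : |x i| * |M i j| * |x j| ≤ C * (|x i| * |x j|) := by
    have := mul_le_mul_of_nonneg_right (hM i j) (mul_nonneg (abs_nonneg (x i)) (abs_nonneg (x j)))
    linarith
  refine h3.trans (mul_le_mul_of_nonneg_left ?_ hC)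
  nlinarith [sq_nonneg (|x i| - |x j|), abs_mul_abs_self (x i), abs_mul_abs_self (x j)]

theorem eigenvalues_le_of_entries {n : ℕ} {A : Matrix (Fin n) (Fin n) ℝ} (hA : A.IsHermitian)
    {C : ℝ} (hC : ∀ i j, |A i j| ≤ C) (i : Fin n) : hA.eigenvalues i ≤ n * C := by
  have h := hA.eigenvalues_eq i
  simp only [star_trivial, RCLike.re_to_real] at h
  rw [h]
  have h1 : (hA.eigenvectorBasis i).ofLp ⬝ᵥ (hA.eigenvectorBasis i).ofLp = 1 := by
    have h := EuclideanSpace.real_norm_sq_eq (hA.eigenvectorBasis i)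
    rw [hA.eigenvectorBasis.orthonormal.1 i] at h
    simpa [dotProduct, sq] using h.symm
  have h2 := (le_abs_self _).trans (abs_dotProduct_mulVec_le hC (hA.eigenvectorBasis i).ofLp)
  rwa [h1, mul_one] at h2

/-- The weight with which a rank one term `q ⊗ q` of the Hessian enters the trace of the
curvature matrix. -/
noncomputable def Ambient.gradWeight (K : Ambient) {n : ℕ} (p : Fin n → ℝ) (s : ℝ)
    (q : Fin n → ℝ) : ℝ :=
  ((graphW p)⁻¹ * deriv K.eta s) * ((gammaTilde p *ᵥ q) ⬝ᵥ (gammaTilde p *ᵥ q))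

theorem Ambient.exists_gradWeight_bounds (K : Ambient) (n : ℕ) {R g a b : ℝ} (hg : 0 < g)
    (hab : Set.Icc a b ⊆ K.range) :
    ∃ c > 0, ∃ C > 0, ∀ (p : Fin n → ℝ) (s : ℝ) (q : Fin n → ℝ), (∀ i, |p i| ≤ R) →
      s ∈ Set.Icc a b → (∀ i, |q i| ≤ R) → g ≤ q ⬝ᵥ q →
      c ≤ K.gradWeight p s q ∧ K.gradWeight p s q ≤ C := by
  let Q : Set ((Fin n → ℝ) × ℝ × (Fin n → ℝ)) :=
    ((Set.univ.pi fun _ => Set.Icc (-R) R) ×ˢ Set.Icc a b ×ˢ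
      (Set.univ.pi fun _ => Set.Icc (-R) R)) ∩ {x | g ≤ x.2.2 ⬝ᵥ x.2.2}
  have hQ : IsCompact Q :=
    ((isCompact_univ_pi fun _ => isCompact_Icc).prod
      (isCompact_Icc.prod (isCompact_univ_pi fun _ => isCompact_Icc))).inter_right
      (isClosed_le continuous_const (by unfold dotProduct; fun_prop))
  have hcont : Continuous fun x : (Fin n → ℝ) × ℝ × (Fin n → ℝ) =>
      K.gradWeight x.1 x.2.1 x.2.2 := by
    have hγ : ∀ i j, Continuous fun x : (Fin n → ℝ) × ℝ × (Fin n → ℝ) => gammaTilde x.1 i j :=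
      fun i j => (contDiff_gammaTilde i j).continuous.comp continuous_fst
    have hW : Continuous fun x : (Fin n → ℝ) × ℝ × (Fin n → ℝ) => (graphW x.1)⁻¹ :=
      ((contDiff_graphW n).continuous.comp continuous_fst).inv₀ fun x => (graphW_pos _).ne'
    have he : Continuous fun x : (Fin n → ℝ) × ℝ × (Fin n → ℝ) => deriv K.eta x.2.1 :=
      K.contDiff_deriv_eta.continuous.comp (by fun_prop)
    unfold Ambient.gradWeight
    simp only [dotProduct, Matrix.mulVec]
    fun_prop
  have hpos : ∀ x ∈ Q, 0 < K.gradWeight x.1 x.2.1 x.2.2 := by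
    rintro ⟨p, s, q⟩ ⟨⟨-, hs, -⟩, hq⟩
    refine mul_pos (mul_pos (inv_pos.2 (graphW_pos p)) (K.deriv_eta_pos (hab hs))) ?_
    have hne : gammaTilde p *ᵥ q ≠ 0 := by
      intro h
      have h0 := gammaTilde_mulVec_eq_zero h
      have : g ≤ q ⬝ᵥ q := hq
      rw [h0] at this
      simp at this
      linarith
    have := Matrix.dotProduct_star_self_pos_iff (v := gammaTilde p *ᵥ q)
    simpa using this.2 hne
  have key : ∃ c > 0, ∃ C > 0, ∀ x ∈ Q, c ≤ K.gradWeight x.1 x.2.1 x.2.2 ∧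
      K.gradWeight x.1 x.2.1 x.2.2 ≤ C := by
    rcases Q.eq_empty_or_nonempty with he | hne
    · exact ⟨1, one_pos, 1, one_pos, by simp [he]⟩
    obtain ⟨x, hx, hx'⟩ := hQ.exists_isMinOn hne hcont.continuousOn
    obtain ⟨y, hy, hy'⟩ := hQ.exists_isMaxOn hne hcont.continuousOn
    exact ⟨_, hpos x hx, _, hpos y hy, fun l hl => ⟨hx' hl, hy' hl⟩⟩
  obtain ⟨c, hc, C, hC, h⟩ := key
  refine ⟨c, hc, C, hC, fun p s q hp hs hq hgq => h (p, s, q) ⟨?_, hgq⟩⟩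
  simp only [Set.mem_prod, Set.mem_pi, Set.mem_univ, true_imp_iff]
  exact ⟨fun i => abs_le.1 (hp i), hs, fun i => abs_le.1 (hq i)⟩

theorem Ambient.dotProduct_curvMat_sub {n : ℕ} (K : Ambient) (r r' : Matrix (Fin n) (Fin n) ℝ)
    (p : Fin n → ℝ) (s : ℝ) (x : Fin n → ℝ) :
    x ⬝ᵥ K.curvMat r p s *ᵥ x = x ⬝ᵥ K.curvMat r' p s *ᵥ x + (graphW p)⁻¹ * deriv K.eta s *
      ((gammaTilde p *ᵥ x) ⬝ᵥ (r - r') *ᵥ (gammaTilde p *ᵥ x)) := by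
  have h : K.curvMat r p s = K.curvMat r' p s +
      ((graphW p)⁻¹ * deriv K.eta s) • (gammaTilde p * (r - r') * gammaTilde p) := by
    simp only [Ambient.curvMat, Matrix.mul_sub, Matrix.sub_mul, smul_add, smul_sub, mul_smul]
    abel
  rw [h, Matrix.add_mulVec, dotProduct_add, Matrix.smul_mulVec, dotProduct_smul, smul_eq_mul]
  congr 2
  rw [← Matrix.mulVec_mulVec, ← Matrix.mulVec_mulVec, Matrix.dotProduct_mulVec,
    ← Matrix.mulVec_transpose, gammaTilde_transpose]

/-- The barrier inequality at a point. The data `q`, `S` stand for the gradient and the Hessian of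
a function `φ`, and `E (α² q ⊗ q + α S)`, `E α q` for those of a small multiple of `exp (α φ)`. For
`α` large the gain `E α²` from the rank one term exceeds the losses, which are `O (E α)`, so the
curvature jumps by more than any fixed multiple of `E`. Only the smaller jet `(r', p', s')` has to
be bounded and to have curvature away from `0`. -/
theorem Ambient.exists_barrier_constants (K : Ambient) {n : ℕ} {f : (Fin n → ℝ) → ℝ}
    (hf : IsCurvatureFunction f) {R g c a b Λ : ℝ} (hR : 0 < R) (hg : 0 < g) (hc : 0 < c)
    (hab : Set.Icc a b ⊆ K.range) (hΛ : 0 ≤ Λ) :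
    ∃ α > 0, ∃ E₀ > 0, ∀ E, 0 < E → E ≤ E₀ →
      ∀ (r r' S : Matrix (Fin n) (Fin n) ℝ) (p p' q : Fin n → ℝ) (s s' : ℝ),
      (∀ i j, |r' i j| ≤ R) → (∀ i j, |S i j| ≤ R) → (∀ i, |p i| ≤ R) → (∀ i, |p' i| ≤ R) →
      (∀ i, |q i| ≤ R) → g ≤ q ⬝ᵥ q → s ∈ Set.Icc a b → s' ∈ Set.Icc a b →
      (∀ i, p i = p' i + E * α * q i) → |s - s'| ≤ E →
      (K.curvMat r p s).PosDef → (K.curvMat r' p' s').PosDef → c ≤ K.G f r' p' s' →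
      (∀ y : Fin n → ℝ, E * (α ^ 2 * (q ⬝ᵥ y) ^ 2 + α * (y ⬝ᵥ S *ᵥ y)) ≤ y ⬝ᵥ (r - r') *ᵥ y) →
      K.G f r' p' s' + Λ * E < K.G f r p s := by
  obtain ⟨L, hL, hLip⟩ := K.exists_curvMat_bounds n (2 * R) a b
  obtain ⟨m, hm, hlow⟩ := hf.exists_lower_bound (M := n * L) hc
  obtain ⟨c₀, hc₀, C₁, hC₁, hgain⟩ := hf.exists_spectral_gain (M := n * L) hm
  obtain ⟨c₃, hc₃, C₄, hC₄, hw⟩ := K.exists_gradWeight_bounds n (R := R) hg hab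
  set D : ℝ := n * (L * (R + 1)) with hD
  have hD0 : 0 ≤ D := by positivity
  let α : ℝ := (C₁ * D + Λ) / (c₀ * c₃) + 1
  have hα1 : 1 ≤ α := by
    have : 0 ≤ (C₁ * D + Λ) / (c₀ * c₃) := by positivity
    simp only [α]; linarith
  have hα0 : 0 < α := by linarith
  have hαbig : C₁ * D + Λ < c₀ * c₃ * α := by
    have : c₀ * c₃ * α = (C₁ * D + Λ) + c₀ * c₃ := by simp only [α]; field_simp
    rw [this]
    have : 0 < c₀ * c₃ := by positivity
    linarith
  obtain ⟨E₀, hE₀, hE1, hE2, hE3⟩ : ∃ E₀ > 0, E₀ * α ≤ 1 ∧ E₀ * (α * D) ≤ m / 2 ∧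
      E₀ * (α ^ 2 * C₄) ≤ 1 := by
    refine ⟨min (1 / α) (min (m / 2 / (α * D + 1)) (1 / (α ^ 2 * C₄))), by positivity, ?_, ?_, ?_⟩
    · exact (le_div_iff₀ hα0).1 (min_le_left _ _)
    · have h := (le_div_iff₀ (by positivity)).1 ((min_le_right (1 / α)
        (min (m / 2 / (α * D + 1)) (1 / (α ^ 2 * C₄)))).trans (min_le_left _ _))
      have h0 : 0 < min (1 / α) (min (m / 2 / (α * D + 1)) (1 / (α ^ 2 * C₄))) := by positivity
      nlinarith
    · exact (le_div_iff₀ (by positivity)).1 ((min_le_right _ _).trans (min_le_right _ _))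
  refine ⟨α, hα0, E₀, hE₀, ?_⟩
  intro E hE hEE r r' S p p' q s s' hr' hS hp hp' hq hgq hs hs' hpq hss hA1 hA2 hcG hrr
  have hEα : E * α ≤ 1 := (mul_le_mul_of_nonneg_right hEE hα0.le).trans hE1
  have hEα0 : 0 < E * α := by positivity
  have hA2h := hA2.isHermitian
  -- compare with the intermediate jet `(r' + E α S, p, s)`
  set d : ℝ := E * α * (R + 1) with hd
  have hd0 : 0 ≤ d := by positivity
  have hbound := hLip (r' + (E * α) • S) r' p p' s s' d
    (fun i j => by
      simp only [Matrix.add_apply, Matrix.smul_apply, smul_eq_mul]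
      refine (abs_add_le _ _).trans ?_
      rw [abs_mul, abs_of_pos hEα0]
      have := mul_le_mul hEα (hS i j) (abs_nonneg _) zero_le_one
      linarith [hr' i j])
    (fun i j => (hr' i j).trans (by linarith))
    (fun i => (hp i).trans (by linarith)) (fun i => (hp' i).trans (by linarith)) hs hs' hd0
    (fun i j => by
      simp only [Matrix.add_apply, Matrix.smul_apply, smul_eq_mul, add_sub_cancel_left]
      rw [abs_mul, abs_of_pos hEα0]
      exact mul_le_mul_of_nonneg_left ((hS i j).trans (by linarith)) hEα0.le)
    (fun i => by
      rw [hpq i, add_sub_cancel_left, abs_mul, abs_of_pos hEα0]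
      exact mul_le_mul_of_nonneg_left ((hq i).trans (by linarith)) hEα0.le)
    (hss.trans (by rw [hd]; nlinarith [mul_le_mul_of_nonneg_left hα1 hE.le]))
  have hA2bd : ∀ i j, |K.curvMat r' p' s' i j| ≤ L := fun i j =>
    (hLip r' r' p' p' s' s' 0 (fun i j => (hr' i j).trans (by linarith))
      (fun i j => (hr' i j).trans (by linarith)) (fun i => (hp' i).trans (by linarith))
      (fun i => (hp' i).trans (by linarith)) hs' hs' le_rfl (by simp) (by simp) (by simp) i j).1
  have hspecM := eigenvalues_le_of_entries hA2h hA2bd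
  have hspecm := hlow hA2h.eigenvalues (fun i => hA2.eigenvalues_pos i) hspecM (by
    rw [← spectralFun_of_isHermitian f hA2h]; exact hcG)
  set κ := (graphW p)⁻¹ * deriv K.eta s with hκ
  have hκ0 : 0 < κ := mul_pos (inv_pos.2 (graphW_pos p)) (K.deriv_eta_pos (hab hs))
  obtain ⟨hw1, hw2⟩ := hw p s q hp hs hq hgq
  have hwdef : κ * ((gammaTilde p *ᵥ q) ⬝ᵥ (gammaTilde p *ᵥ q)) = K.gradWeight p s q := rfl
  have hEα2 : 0 < E * α ^ 2 := by positivity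
  have htr : κ * (E * α ^ 2) * ((gammaTilde p *ᵥ q) ⬝ᵥ (gammaTilde p *ᵥ q)) =
      E * α ^ 2 * K.gradWeight p s q := by rw [← hwdef]; ring
  have hδ : E * α * D ≤ m / 2 := by
    have := mul_le_mul_of_nonneg_right hEE (by positivity : 0 ≤ α * D)
    linarith
  have h := hgain (K.curvMat r' p' s') (K.curvMat r p s) hA2h hA1 (gammaTilde p *ᵥ q)
    (κ * (E * α ^ 2)) (E * α * D) hspecm hspecM (by positivity) hδ (by positivity)
    (by
      rw [htr]
      have h1 := mul_le_mul_of_nonneg_left hw2 hEα2.le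
      have h2 := mul_le_mul_of_nonneg_right hEE (by positivity : 0 ≤ α ^ 2 * C₄)
      linarith)
    (fun x => by
      have h1 := K.dotProduct_curvMat_sub r (r' + (E * α) • S) p s x
      have h2 := abs_dotProduct_mulVec_le
        (M := K.curvMat (r' + (E * α) • S) p s - K.curvMat r' p' s') (fun i j => (hbound i j).2) x
      rw [Matrix.sub_mulVec, dotProduct_sub] at h2
      have h3 := hrr (gammaTilde p *ᵥ x)
      have h4 : (gammaTilde p *ᵥ x) ⬝ᵥ (r - (r' + (E * α) • S)) *ᵥ (gammaTilde p *ᵥ x) =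
          (gammaTilde p *ᵥ x) ⬝ᵥ (r - r') *ᵥ (gammaTilde p *ᵥ x) -
            E * α * ((gammaTilde p *ᵥ x) ⬝ᵥ S *ᵥ (gammaTilde p *ᵥ x)) := by
        rw [← sub_sub, Matrix.sub_mulVec, dotProduct_sub, Matrix.smul_mulVec, dotProduct_smul,
          smul_eq_mul]
      have h5 : (gammaTilde p *ᵥ q) ⬝ᵥ x = q ⬝ᵥ (gammaTilde p *ᵥ x) := by
        rw [Matrix.dotProduct_mulVec, ← Matrix.mulVec_transpose, gammaTilde_transpose]
      have h6 : E * α ^ 2 * (q ⬝ᵥ (gammaTilde p *ᵥ x)) ^ 2 ≤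
          (gammaTilde p *ᵥ x) ⬝ᵥ (r - (r' + (E * α) • S)) *ᵥ (gammaTilde p *ᵥ x) := by
        rw [h4]; linarith
      have h7 := mul_le_mul_of_nonneg_left h6 hκ0.le
      have h8 := (abs_le.1 h2).1
      have h9 : n * (L * d) * (x ⬝ᵥ x) = E * α * D * (x ⬝ᵥ x) := by rw [hd, hD]; ring
      rw [h1, h5, ← hκ]
      linarith)
  rw [htr] at h
  have h10 := mul_le_mul_of_nonneg_left (mul_le_mul_of_nonneg_left hw1 hEα2.le) hc₀.le
  have h11 : c₀ * (E * α ^ 2 * c₃) = E * α * (c₀ * c₃ * α) := by ring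
  have h12 : E * α * (C₁ * D + Λ) < E * α * (c₀ * c₃ * α) :=
    mul_lt_mul_of_pos_left hαbig hEα0
  have h13 : Λ * E ≤ E * α * Λ := by nlinarith [mul_nonneg hE.le hΛ]
  show spectralFun f _ + Λ * E < spectralFun f _
  linarith

/-! ### The extension along rays -/

theorem rayExt_coe {n : ℕ} (v : Sph n → ℝ) (z : Sph n) : rayExt v z = v z := by
  have hz : ‖(z : EuclideanSpace ℝ (Fin (n + 1)))‖ = 1 := norm_eq_of_mem_sphere z
  rw [rayExt, dif_neg (ne_zero_of_mem_unit_sphere z)]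
  congr 1
  ext1
  simp [hz]

theorem rayExt_smul {n : ℕ} (v : Sph n → ℝ) (z : Sph n) {c : ℝ} (hc : 0 < c) :
    rayExt v (c • (z : EuclideanSpace ℝ (Fin (n + 1)))) = v z := by
  have hz : ‖(z : EuclideanSpace ℝ (Fin (n + 1)))‖ = 1 := norm_eq_of_mem_sphere z
  rw [rayExt, dif_neg (smul_ne_zero hc.ne' (ne_zero_of_mem_unit_sphere z))]
  congr 1
  ext1
  simp [norm_smul, hz, abs_of_pos hc, smul_smul, inv_mul_cancel₀ hc.ne']

/-- Near a point of the sphere the normalization `x ↦ x / |x|` agrees with a map to the sphere that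
is smooth on the whole space: `x` is first moved, by a bump function, to a vector that does not
vanish anywhere. -/
theorem exists_smooth_normalization {n : ℕ} (z : Sph n) :
    ∃ N : EuclideanSpace ℝ (Fin (n + 1)) → Sph n,
      ContMDiff 𝓘(ℝ, EuclideanSpace ℝ (Fin (n + 1))) (𝓡 n) ∞ N ∧ N z = z ∧
      ∀ᶠ x in 𝓝 (z : EuclideanSpace ℝ (Fin (n + 1))), ∀ v : Sph n → ℝ, rayExt v x = v (N x) := by
  have := Fact.mk (finrank_euclideanSpace_fin (𝕜 := ℝ) (n := n + 1))
  let ρ : ContDiffBump (z : EuclideanSpace ℝ (Fin (n + 1))) :=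
    ⟨1 / 4, 1 / 2, by norm_num, by norm_num⟩
  have hz : ‖(z : EuclideanSpace ℝ (Fin (n + 1)))‖ = 1 := norm_eq_of_mem_sphere z
  let g : EuclideanSpace ℝ (Fin (n + 1)) → EuclideanSpace ℝ (Fin (n + 1)) :=
    fun x => z + ρ x • (x - z)
  have hg : ContDiff ℝ ∞ g := contDiff_const.add (ρ.contDiff.smul (contDiff_id.sub contDiff_const))
  have hg0 : ∀ x, g x ≠ 0 := by
    intro x hx
    have h1 : ‖ρ x • (x - (z : EuclideanSpace ℝ (Fin (n + 1))))‖ < 1 := by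
      rcases lt_or_ge (dist x z) (1 / 2) with h | h
      · rw [norm_smul, Real.norm_of_nonneg ρ.nonneg, ← dist_eq_norm]
        have := ρ.le_one (x := x)
        have := ρ.nonneg (x := x)
        nlinarith [dist_nonneg (x := x) (y := (z : EuclideanSpace ℝ (Fin (n + 1))))]
      · rw [ρ.zero_of_le_dist h]; simp
    have h2 : ρ x • (x - (z : EuclideanSpace ℝ (Fin (n + 1)))) = -z := by
      have : (z : EuclideanSpace ℝ (Fin (n + 1))) + ρ x • (x - z) = 0 := hx
      exact (neg_eq_of_add_eq_zero_right this).symm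
    rw [h2, norm_neg, hz] at h1
    exact lt_irrefl _ h1
  have hN : ContDiff ℝ ∞ fun x => ‖g x‖⁻¹ • g x :=
    ((hg.norm ℝ hg0).inv fun x => norm_ne_zero_iff.2 (hg0 x)).smul hg
  have hmem : ∀ x, ‖g x‖⁻¹ • g x ∈ Metric.sphere (0 : EuclideanSpace ℝ (Fin (n + 1))) 1 := by
    intro x
    rw [mem_sphere_zero_iff_norm, norm_smul, norm_inv, norm_norm,
      inv_mul_cancel₀ (norm_ne_zero_iff.mpr (hg0 x))]
  have hev : ∀ᶠ x in 𝓝 (z : EuclideanSpace ℝ (Fin (n + 1))), g x = x := by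
    filter_upwards [ρ.eventuallyEq_one] with x hx
    simp [g, hx]
  refine ⟨Set.codRestrict _ _ hmem, hN.contMDiff.codRestrict_sphere hmem, ?_, ?_⟩
  · ext1
    simp [g, hz]
  · filter_upwards [hev] with x hx v
    have hx0 : x ≠ 0 := hx ▸ hg0 x
    rw [rayExt, dif_neg hx0]
    congr 1
    ext1
    simp [hx]

theorem contDiffAt_rayExt {n : ℕ} {v : Sph n → ℝ} {z : Sph n} {m : ℕ∞}
    (hv : ContMDiffAt (𝓡 n) 𝓘(ℝ, ℝ) m v z) :
    ContDiffAt ℝ m (rayExt v) (z : EuclideanSpace ℝ (Fin (n + 1))) := by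
  obtain ⟨N, hN, hNz, hev⟩ := exists_smooth_normalization z
  rw [← contMDiffAt_iff_contDiffAt]
  have h1 : ContMDiffAt 𝓘(ℝ, EuclideanSpace ℝ (Fin (n + 1))) 𝓘(ℝ, ℝ) m (v ∘ N) z :=
    ContMDiffAt.comp (z : EuclideanSpace ℝ (Fin (n + 1))) (by rwa [hNz])
      ((hN.of_le (by exact_mod_cast le_top)).contMDiffAt)
  exact h1.congr_of_eventuallyEq (hev.mono fun x hx => hx v)

theorem continuousAt_of_rayExt {n : ℕ} {v : Sph n → ℝ} {z : Sph n}
    (h : ContinuousAt (rayExt v) (z : EuclideanSpace ℝ (Fin (n + 1)))) : ContinuousAt v z := by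
  have : v = rayExt v ∘ ((↑) : Sph n → EuclideanSpace ℝ (Fin (n + 1))) :=
    funext fun y => (rayExt_coe v y).symm
  rw [this]
  exact ContinuousAt.comp h continuous_subtype_val.continuousAt

theorem isLocalMin_rayExt {n : ℕ} {v : Sph n → ℝ} {z : Sph n} (h : IsLocalMin v z) :
    IsLocalMin (rayExt v) (z : EuclideanSpace ℝ (Fin (n + 1))) := by
  obtain ⟨N, hN, hNz, hev⟩ := exists_smooth_normalization z
  have ht : Tendsto N (𝓝 (z : EuclideanSpace ℝ (Fin (n + 1)))) (𝓝 z) := by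
    have := hN.continuous.tendsto (z : EuclideanSpace ℝ (Fin (n + 1)))
    rwa [hNz] at this
  filter_upwards [hev, ht.eventually h] with x hx hx'
  rw [hx, rayExt_coe]
  exact hx'

theorem rayExt_eventuallyEq {n : ℕ} {v v' : Sph n → ℝ} {z : Sph n} (h : v =ᶠ[𝓝 z] v') :
    rayExt v =ᶠ[𝓝 (z : EuclideanSpace ℝ (Fin (n + 1)))] rayExt v' := by
  obtain ⟨N, hN, hNz, hev⟩ := exists_smooth_normalization z
  have ht : Tendsto N (𝓝 (z : EuclideanSpace ℝ (Fin (n + 1)))) (𝓝 z) := by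
    have := hN.continuous.tendsto (z : EuclideanSpace ℝ (Fin (n + 1)))
    rwa [hNz] at this
  filter_upwards [hev, ht.eventually h] with x hx hx'
  rw [hx, hx]
  exact hx'

theorem rayExt_sub {n : ℕ} (v v' : Sph n → ℝ) :
    rayExt (fun y => v y - v' y) = fun x => rayExt v x - rayExt v' x := by
  ext x
  unfold rayExt
  split_ifs <;> simp

/-! ### Gradient and Hessian in the frame -/

theorem inner_grad {n : ℕ} (v : Sph n → ℝ) (z : Sph n) (X : EuclideanSpace ℝ (Fin (n + 1))) :
    inner ℝ (grad v z) X = fderiv ℝ (rayExt v) (z : EuclideanSpace ℝ (Fin (n + 1))) X := by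
  rw [grad, gradient, InnerProductSpace.toDual_symm_apply]

theorem gradVec_apply {n : ℕ} (v : Sph n → ℝ) (z : Sph n) (i : Fin n) :
    gradVec v z i = fderiv ℝ (rayExt v) (z : EuclideanSpace ℝ (Fin (n + 1))) (frame z i) :=
  inner_grad v z _

theorem norm_frame {n : ℕ} (z : Sph n) (i : Fin n) : ‖frame z i‖ = 1 := by
  have := Fact.mk (finrank_euclideanSpace_fin (𝕜 := ℝ) (n := n + 1))
  exact (OrthonormalBasis.fromOrthogonalSpanSingleton (𝕜 := ℝ) n
    (ne_zero_of_mem_unit_sphere z)).orthonormal.1 i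

theorem abs_gradVec_le {n : ℕ} (v : Sph n → ℝ) (z : Sph n) (i : Fin n) :
    |gradVec v z i| ≤ ‖fderiv ℝ (rayExt v) (z : EuclideanSpace ℝ (Fin (n + 1)))‖ := by
  rw [gradVec_apply]
  have := (fderiv ℝ (rayExt v) (z : EuclideanSpace ℝ (Fin (n + 1)))).le_opNorm (frame z i)
  rwa [norm_frame, mul_one] at this

theorem abs_hessMat_le {n : ℕ} (v : Sph n → ℝ) (z : Sph n) (i j : Fin n) :
    |hessMat v z i j| ≤
      ‖fderiv ℝ (fderiv ℝ (rayExt v)) (z : EuclideanSpace ℝ (Fin (n + 1)))‖ := by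
  have := (fderiv ℝ (fderiv ℝ (rayExt v)) (z : EuclideanSpace ℝ (Fin (n + 1)))).le_opNorm₂
    (frame z i) (frame z j)
  rwa [norm_frame, norm_frame, mul_one, mul_one] at this

/-- The extension is constant along rays, so the gradient is tangent to the sphere and its length
can be computed in the frame. -/
theorem gradVec_dotProduct_self {n : ℕ} {v : Sph n → ℝ} {z : Sph n}
    (hv : DifferentiableAt ℝ (rayExt v) (z : EuclideanSpace ℝ (Fin (n + 1)))) :
    gradVec v z ⬝ᵥ gradVec v z = ‖grad v z‖ ^ 2 := by
  have := Fact.mk (finrank_euclideanSpace_fin (𝕜 := ℝ) (n := n + 1))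
  let b := OrthonormalBasis.fromOrthogonalSpanSingleton (𝕜 := ℝ) n (ne_zero_of_mem_unit_sphere z)
  have h0 : fderiv ℝ (rayExt v) (z : EuclideanSpace ℝ (Fin (n + 1))) z = 0 := by
    have hl : HasDerivAt (fun c : ℝ => c • (z : EuclideanSpace ℝ (Fin (n + 1)))) z 1 := by
      simpa using (hasDerivAt_id (1 : ℝ)).smul_const (z : EuclideanSpace ℝ (Fin (n + 1)))
    have hv' : HasFDerivAt (rayExt v) (fderiv ℝ (rayExt v) (z : EuclideanSpace ℝ (Fin (n + 1))))
        ((1 : ℝ) • (z : EuclideanSpace ℝ (Fin (n + 1)))) := by simpa using hv.hasFDerivAt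
    have h1 := hv'.comp_hasDerivAt (1 : ℝ) hl
    have h2 : HasDerivAt (fun c : ℝ => rayExt v (c • (z : EuclideanSpace ℝ (Fin (n + 1))))) 0 1 := by
      refine (hasDerivAt_const (1 : ℝ) (v z)).congr_of_eventuallyEq ?_
      filter_upwards [lt_mem_nhds (zero_lt_one (α := ℝ))] with c hc
      exact rayExt_smul v z hc
    exact h1.unique h2
  have hmem : grad v z ∈ (Submodule.span ℝ {(z : EuclideanSpace ℝ (Fin (n + 1)))})ᗮ := by
    rw [Submodule.mem_orthogonal_singleton_iff_inner_left, inner_grad, h0]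
  have h := b.sum_sq_norm_inner_left ⟨grad v z, hmem⟩
  rw [Submodule.coe_norm] at h
  simp only at h
  rw [← h]
  simp only [dotProduct]
  refine Finset.sum_congr rfl fun i _ => ?_
  rw [Real.norm_eq_abs, sq_abs, sq]
  rfl

theorem dotProduct_gradVec {n : ℕ} (v : Sph n → ℝ) (z : Sph n) (y : Fin n → ℝ) :
    gradVec v z ⬝ᵥ y =
      fderiv ℝ (rayExt v) (z : EuclideanSpace ℝ (Fin (n + 1))) (∑ i, y i • frame z i) := by
  rw [map_sum]
  simp only [dotProduct, map_smul, smul_eq_mul, gradVec_apply]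
  exact Finset.sum_congr rfl fun i _ => mul_comm _ _

theorem dotProduct_hessMat {n : ℕ} (v : Sph n → ℝ) (z : Sph n) (y : Fin n → ℝ) :
    y ⬝ᵥ hessMat v z *ᵥ y = hess v z (∑ i, y i • frame z i) (∑ i, y i • frame z i) := by
  simp only [hess, map_sum, map_smul, _root_.sum_apply, _root_.smul_apply,
    smul_eq_mul, dotProduct, Matrix.mulVec, hessMat, Matrix.of_apply, Finset.mul_sum]
  rw [Finset.sum_comm]
  exact Finset.sum_congr rfl fun i _ => Finset.sum_congr rfl fun j _ => by ring

/-! ### Jets at a minimum -/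

theorem second_deriv_nonneg_of_isLocalMin {g g' : ℝ → ℝ} {g'' : ℝ}
    (hg : ∀ᶠ s in 𝓝 (0 : ℝ), HasDerivAt g (g' s) s) (hg' : HasDerivAt g' g'' 0)
    (hmin : IsLocalMin g 0) : 0 ≤ g'' := by
  by_contra hneg
  push Not at hneg
  have hd : deriv g =ᶠ[𝓝 0] g' := hg.mono fun s hs => hs.deriv
  have hdd : deriv (deriv g) 0 = g'' := hd.deriv_eq.trans hg'.deriv
  -- otherwise `0` is also a local maximum, and `g` is locally constant
  have hmax : IsLocalMax g 0 := isLocalMax_of_deriv_deriv_neg (by rwa [hdd]) hmin.deriv_eq_zero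
    hg.self_of_nhds.continuousAt
  have hconst : g =ᶠ[𝓝 0] fun _ => g 0 := by
    filter_upwards [hmin, hmax] with s h1 h2 using le_antisymm h2 h1
  have h1 : deriv (deriv g) 0 = 0 := by
    have h2 : deriv g =ᶠ[𝓝 0] deriv fun _ => g 0 := hconst.deriv
    rw [h2.deriv_eq]
    simp
  linarith

theorem hasDerivAt_line {E : Type*} [NormedAddCommGroup E] [NormedSpace ℝ E] (x X : E) (s : ℝ) :
    HasDerivAt (fun s : ℝ => x + s • X) X s := by
  simpa using ((hasDerivAt_id s).smul_const X).const_add x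

theorem eventually_hasDerivAt_line {E : Type*} [NormedAddCommGroup E] [NormedSpace ℝ E]
    {u : E → ℝ} {x : E} (hu : ContDiffAt ℝ 2 u x) (X : E) :
    ∀ᶠ s in 𝓝 (0 : ℝ), HasDerivAt (fun s : ℝ => u (x + s • X)) (fderiv ℝ u (x + s • X) X) s := by
  have ht : Tendsto (fun s : ℝ => x + s • X) (𝓝 0) (𝓝 x) := by
    have := (hasDerivAt_line x X 0).continuousAt.tendsto
    simpa using this
  filter_upwards [ht.eventually (hu.eventually (by simp))] with s hs
  exact (hs.differentiableAt (by simp)).hasFDerivAt.comp_hasDerivAt s (hasDerivAt_line x X s)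

theorem hasDerivAt_fderiv_line {E : Type*} [NormedAddCommGroup E] [NormedSpace ℝ E]
    {u : E → ℝ} {x : E} (hu : ContDiffAt ℝ 2 u x) (X : E) :
    HasDerivAt (fun s : ℝ => fderiv ℝ u (x + s • X) X) (fderiv ℝ (fderiv ℝ u) x X X) 0 := by
  have h1 : DifferentiableAt ℝ (fderiv ℝ u) x :=
    (hu.fderiv_right (m := 1) (by norm_num)).differentiableAt (by simp)
  have h2 : HasDerivAt (fun s : ℝ => fderiv ℝ u (x + s • X)) (fderiv ℝ (fderiv ℝ u) x X) 0 :=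
    HasFDerivAt.comp_hasDerivAt (0 : ℝ) (by simpa using h1.hasFDerivAt) (hasDerivAt_line x X 0)
  simpa using h2.clm_apply (hasDerivAt_const (0 : ℝ) X)

/-- The first and second derivatives of `u` at a point where `u` minus a multiple of the barrier
`exp (α Φ) - 1` has a local minimum. -/
theorem fderiv_of_isLocalMin_sub_barrier {E : Type*} [NormedAddCommGroup E] [NormedSpace ℝ E]
    {u Φ : E → ℝ} {x : E} {τ α : ℝ} (hu : ContDiffAt ℝ 2 u x) (hΦ : ContDiffAt ℝ 2 Φ x)
    (hmin : IsLocalMin (fun y => u y - τ * (Real.exp (α * Φ y) - 1)) x) (X : E) :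
    fderiv ℝ u x X = τ * Real.exp (α * Φ x) * α * fderiv ℝ Φ x X ∧
    τ * Real.exp (α * Φ x) * (α ^ 2 * (fderiv ℝ Φ x X) ^ 2 + α * fderiv ℝ (fderiv ℝ Φ) x X X) ≤
      fderiv ℝ (fderiv ℝ u) x X X := by
  have ht : Tendsto (fun s : ℝ => x + s • X) (𝓝 0) (𝓝 x) := by
    have := (hasDerivAt_line x X 0).continuousAt.tendsto
    simpa using this
  have hmin' : IsLocalMin (fun s : ℝ => u (x + s • X) - τ * (Real.exp (α * Φ (x + s • X)) - 1)) 0 := by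
    filter_upwards [ht.eventually hmin] with s hs
    simpa using hs
  have h1 : ∀ᶠ s in 𝓝 (0 : ℝ),
      HasDerivAt (fun s : ℝ => u (x + s • X) - τ * (Real.exp (α * Φ (x + s • X)) - 1))
        (fderiv ℝ u (x + s • X) X -
          τ * (Real.exp (α * Φ (x + s • X)) * (α * fderiv ℝ Φ (x + s • X) X))) s := by
    filter_upwards [eventually_hasDerivAt_line hu X, eventually_hasDerivAt_line hΦ X] with s h2 h3
    exact h2.sub (((h3.const_mul α).exp.sub_const 1).const_mul τ)
  have hΦ0 := (eventually_hasDerivAt_line hΦ X).self_of_nhds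
  have h2 : HasDerivAt (fun s : ℝ => fderiv ℝ u (x + s • X) X -
      τ * (Real.exp (α * Φ (x + s • X)) * (α * fderiv ℝ Φ (x + s • X) X))) _ 0 :=
    (hasDerivAt_fderiv_line hu X).sub
      ((((hΦ0.const_mul α).exp).mul ((hasDerivAt_fderiv_line hΦ X).const_mul α)).const_mul τ)
  have h3 := hmin'.hasDerivAt_eq_zero h1.self_of_nhds
  have h4 := second_deriv_nonneg_of_isLocalMin h1 h2 hmin'
  simp only [zero_smul, add_zero] at h3 h4
  constructor <;> linarith

/-! ### The Hopf lemma for the curvature operator -/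

theorem inner_lt_one_of_ne {n : ℕ} {y z : Sph n} (h : y ≠ z) :
    inner ℝ (y : EuclideanSpace ℝ (Fin (n + 1))) z < 1 := by
  have hy : ‖(y : EuclideanSpace ℝ (Fin (n + 1)))‖ = 1 := norm_eq_of_mem_sphere y
  have hz : ‖(z : EuclideanSpace ℝ (Fin (n + 1)))‖ = 1 := norm_eq_of_mem_sphere z
  refine lt_of_le_of_ne ?_ fun he => h (Subtype.ext ?_)
  · simpa [hy, hz] using real_inner_le_norm (y : EuclideanSpace ℝ (Fin (n + 1))) z
  · exact (inner_eq_one_iff_of_norm_eq_one hy hz).1 he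

theorem inner_coe_self {n : ℕ} (z : Sph n) :
    inner ℝ (z : EuclideanSpace ℝ (Fin (n + 1))) z = 1 := by
  rw [real_inner_self_eq_norm_sq, norm_eq_of_mem_sphere z, one_pow]

theorem contMDiff_inner_right {n : ℕ} (X : EuclideanSpace ℝ (Fin (n + 1))) {m : ℕ∞} :
    ContMDiff (𝓡 n) 𝓘(ℝ, ℝ) m
      fun y : Sph n => inner ℝ (y : EuclideanSpace ℝ (Fin (n + 1))) X := by
  have := Fact.mk (finrank_euclideanSpace_fin (𝕜 := ℝ) (n := n + 1))
  have h1 : ContMDiff (𝓡 n) 𝓘(ℝ, EuclideanSpace ℝ (Fin (n + 1))) m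
      ((↑) : Sph n → EuclideanSpace ℝ (Fin (n + 1))) := contMDiff_coe_sphere
  have h2 : ContDiff ℝ m fun y : EuclideanSpace ℝ (Fin (n + 1)) => inner ℝ y X :=
    contDiff_id.inner ℝ contDiff_const
  exact h2.contMDiff.comp h1

theorem eventually_norm_le_add_one {X F : Type*} [TopologicalSpace X] [NormedAddCommGroup F]
    {g : X → F} {x : X} (h : ContinuousAt g x) : ∀ᶠ y in 𝓝 x, ‖g y‖ ≤ ‖g x‖ + 1 :=
  h.norm.tendsto.eventually_le_const (lt_add_one _)

theorem eventually_norm_fderiv_le {E : Type*} [NormedAddCommGroup E] [NormedSpace ℝ E]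
    {u : E → ℝ} {x : E} (hu : ContDiffAt ℝ 2 u x) :
    ∃ R > 0, ∀ᶠ y in 𝓝 x, ContDiffAt ℝ 2 u y ∧ ‖fderiv ℝ u y‖ ≤ R ∧
      ‖fderiv ℝ (fderiv ℝ u) y‖ ≤ R := by
  have h1 : ContDiffAt ℝ 1 (fderiv ℝ u) x := hu.fderiv_right (by norm_num)
  have h2 : ContDiffAt ℝ 0 (fderiv ℝ (fderiv ℝ u)) x := h1.fderiv_right (by norm_num)
  refine ⟨‖fderiv ℝ u x‖ + ‖fderiv ℝ (fderiv ℝ u) x‖ + 1, by positivity, ?_⟩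
  filter_upwards [eventually_norm_le_add_one h1.continuousAt,
    eventually_norm_le_add_one h2.continuousAt, hu.eventually (by simp)] with y hy1 hy2 hy3
  have h3 := norm_nonneg (fderiv ℝ u x)
  have h4 := norm_nonneg (fderiv ℝ (fderiv ℝ u) x)
  exact ⟨hy3, by linarith, by linarith⟩

/-- Near `z`, the bounds on the 2-jets that the barrier argument requires. -/
theorem eventually_jet_bounds {n : ℕ} {v : Sph n → ℝ} {z : Sph n}
    (hv : ContMDiffAt (𝓡 n) 𝓘(ℝ, ℝ) 2 v z) :
    ∃ R > 0, ∀ᶠ y : Sph n in 𝓝 z, ContDiffAt ℝ 2 (rayExt v) (y : EuclideanSpace ℝ (Fin (n + 1))) ∧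
      (∀ i, |gradVec v y i| ≤ R) ∧ ∀ i j, |hessMat v y i j| ≤ R := by
  obtain ⟨R, hR, hev⟩ := eventually_norm_fderiv_le (contDiffAt_rayExt (m := 2) hv)
  have hc : Tendsto ((↑) : Sph n → EuclideanSpace ℝ (Fin (n + 1))) (𝓝 z) (𝓝 z) :=
    continuous_subtype_val.continuousAt
  refine ⟨R, hR, ?_⟩
  filter_upwards [hc.eventually hev] with y hy
  exact ⟨hy.1, fun i => (abs_gradVec_le v y i).trans hy.2.1,
    fun i j => (abs_hessMat_le v y i j).trans hy.2.2⟩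

theorem grad_eq_zero_of_isLocalMin {n : ℕ} {v : Sph n → ℝ} {z : Sph n} (h : IsLocalMin v z) :
    grad v z = 0 := by
  rw [grad, gradient, (isLocalMin_rayExt h).fderiv_eq_zero, map_zero]

theorem grad_sub {n : ℕ} {v v' : Sph n → ℝ} {z : Sph n}
    (hv : DifferentiableAt ℝ (rayExt v) (z : EuclideanSpace ℝ (Fin (n + 1))))
    (hv' : DifferentiableAt ℝ (rayExt v') (z : EuclideanSpace ℝ (Fin (n + 1)))) :
    grad (fun y => v y - v' y) z = grad v z - grad v' z := by
  rw [grad, grad, grad, rayExt_sub, gradient, gradient, gradient, fderiv_fun_sub hv hv', map_sub]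

/-- At a local minimum of `v - v'` minus a barrier, the gradients and Hessians in the frame differ
by those of the barrier. -/
theorem frame_jets_of_isLocalMin {n : ℕ} {v v' φ : Sph n → ℝ} {z : Sph n} {τ α : ℝ}
    (hv : ContDiffAt ℝ 2 (rayExt v) (z : EuclideanSpace ℝ (Fin (n + 1))))
    (hv' : ContDiffAt ℝ 2 (rayExt v') (z : EuclideanSpace ℝ (Fin (n + 1))))
    (hφ : ContDiffAt ℝ 2 (rayExt φ) (z : EuclideanSpace ℝ (Fin (n + 1))))
    (hmin : IsLocalMin (fun y => (v y - v' y) - τ * (Real.exp (α * φ y) - 1)) z) :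
    (∀ i, gradVec v z i = gradVec v' z i + τ * Real.exp (α * φ z) * α * gradVec φ z i) ∧
    ∀ y : Fin n → ℝ, τ * Real.exp (α * φ z) *
        (α ^ 2 * (gradVec φ z ⬝ᵥ y) ^ 2 + α * (y ⬝ᵥ hessMat φ z *ᵥ y)) ≤
      y ⬝ᵥ (hessMat v z - hessMat v' z) *ᵥ y := by
  have hmin' : IsLocalMin (fun x : EuclideanSpace ℝ (Fin (n + 1)) =>
      (rayExt v x - rayExt v' x) - τ * (Real.exp (α * rayExt φ x) - 1)) z := by
    refine (isLocalMin_rayExt hmin).congr ?_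
    obtain ⟨N, hN, hNz, hev⟩ := exists_smooth_normalization z
    filter_upwards [hev] with x hx
    rw [hx, hx, hx, hx]
  have hu : ContDiffAt ℝ 2 (fun x => rayExt v x - rayExt v' x)
      (z : EuclideanSpace ℝ (Fin (n + 1))) := hv.sub hv'
  have key := fderiv_of_isLocalMin_sub_barrier hu hφ hmin'
  have hd1 : fderiv ℝ (fun x => rayExt v x - rayExt v' x)
      =ᶠ[𝓝 (z : EuclideanSpace ℝ (Fin (n + 1)))]
      fun x => fderiv ℝ (rayExt v) x - fderiv ℝ (rayExt v') x := by
    filter_upwards [hv.eventually (by simp), hv'.eventually (by simp)] with x hx hx'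
    exact fderiv_fun_sub (hx.differentiableAt (by simp)) (hx'.differentiableAt (by simp))
  have hd2 : fderiv ℝ (fderiv ℝ (fun x => rayExt v x - rayExt v' x))
      (z : EuclideanSpace ℝ (Fin (n + 1))) =
      fderiv ℝ (fderiv ℝ (rayExt v)) z - fderiv ℝ (fderiv ℝ (rayExt v')) z := by
    rw [hd1.fderiv_eq]
    exact fderiv_fun_sub
      ((hv.fderiv_right (m := 1) (by norm_num)).differentiableAt (by simp))
      ((hv'.fderiv_right (m := 1) (by norm_num)).differentiableAt (by simp))
  have hd1z := hd1.self_of_nhds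
  simp only [rayExt_coe] at key
  constructor
  · intro i
    have h := (key (frame z i)).1
    rw [hd1z, _root_.sub_apply] at h
    rw [gradVec_apply, gradVec_apply, gradVec_apply]
    linarith
  · intro y
    have h := (key (∑ i, y i • frame z i)).2
    rw [hd2, _root_.sub_apply, _root_.sub_apply] at h
    rw [Matrix.sub_mulVec, dotProduct_sub, dotProduct_hessMat, dotProduct_hessMat,
      dotProduct_hessMat, dotProduct_gradVec]
    exact h

/-- If `u ≥ τ (exp (α φ) - 1)` where `φ ≥ 0`, with equality at a boundary point `z`, then `u` grows
from `z` in the direction of `grad φ`. -/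
theorem inner_grad_pos_of_barrier_le {n : ℕ} {u φ : Sph n → ℝ} {z : Sph n} {τ α : ℝ}
    (hτ : 0 < τ) (hα : 0 < α)
    (hu : DifferentiableAt ℝ (rayExt u) (z : EuclideanSpace ℝ (Fin (n + 1))))
    (hφ : DifferentiableAt ℝ (rayExt φ) (z : EuclideanSpace ℝ (Fin (n + 1))))
    (huz : u z = 0) (hφz : φ z = 0) (hg : grad φ z ≠ 0)
    (hle : ∀ᶠ y in 𝓝 z, 0 ≤ φ y → τ * (Real.exp (α * φ y) - 1) ≤ u y) :
    0 < inner ℝ (grad u z) (grad φ z) := by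
  set q := grad φ z
  have line : ∀ {w : Sph n → ℝ},
      DifferentiableAt ℝ (rayExt w) (z : EuclideanSpace ℝ (Fin (n + 1))) →
      HasDerivAt (fun s : ℝ => rayExt w ((z : EuclideanSpace ℝ (Fin (n + 1))) + s • q))
        (inner ℝ (grad w z) q) 0 := by
    intro w hw
    have hw' : HasFDerivAt (rayExt w) (fderiv ℝ (rayExt w) (z : EuclideanSpace ℝ (Fin (n + 1))))
        ((z : EuclideanSpace ℝ (Fin (n + 1))) + (0 : ℝ) • q) := by simpa using hw.hasFDerivAt
    rw [inner_grad]
    exact hw'.comp_hasDerivAt (0 : ℝ) (hasDerivAt_line _ q 0)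
  have hq : 0 < inner ℝ q q := real_inner_self_pos.2 hg
  have hφl := line hφ
  have hgl := (line hu).sub (((hφl.const_mul α).exp.sub_const 1).const_mul τ)
  simp only [zero_smul, add_zero, rayExt_coe, hφz, mul_zero, Real.exp_zero, one_mul] at hgl
  obtain ⟨N, hN, hNz, hev⟩ := exists_smooth_normalization z
  have hline : Tendsto (fun s : ℝ => (z : EuclideanSpace ℝ (Fin (n + 1))) + s • q) (𝓝 0)
      (𝓝 (z : EuclideanSpace ℝ (Fin (n + 1)))) := by
    simpa using (hasDerivAt_line (z : EuclideanSpace ℝ (Fin (n + 1))) q 0).continuousAt.tendsto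
  have hNt : Tendsto N (𝓝 (z : EuclideanSpace ℝ (Fin (n + 1)))) (𝓝 z) := by
    have := hN.continuous.tendsto (z : EuclideanSpace ℝ (Fin (n + 1)))
    rwa [hNz] at this
  have hle' : ∀ᶠ s : ℝ in 𝓝 0, 0 ≤ rayExt φ ((z : EuclideanSpace ℝ (Fin (n + 1))) + s • q) →
      0 ≤ rayExt u ((z : EuclideanSpace ℝ (Fin (n + 1))) + s • q) -
        τ * (Real.exp (α * rayExt φ ((z : EuclideanSpace ℝ (Fin (n + 1))) + s • q)) - 1) := by
    filter_upwards [hline.eventually hev, hline.eventually (hNt.eventually hle)] with s h1 h2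
    rw [h1, h1]
    exact fun h => sub_nonneg.2 (h2 h)
  have hmono : 𝓝[>] (0 : ℝ) ≤ 𝓝[≠] 0 :=
    nhdsWithin_mono _ fun s hs => ne_of_gt hs
  have hφpos : ∀ᶠ s : ℝ in 𝓝[>] 0,
      0 < rayExt φ ((z : EuclideanSpace ℝ (Fin (n + 1))) + s • q) := by
    have ht := (hφl.tendsto_slope.mono_left hmono).eventually (lt_mem_nhds hq)
    filter_upwards [ht, self_mem_nhdsWithin] with s hs hs0
    have hs0' : (0 : ℝ) < s := hs0
    rw [slope_def_field] at hs
    simp only [zero_smul, add_zero, rayExt_coe, hφz, sub_zero] at hs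
    exact (div_pos_iff_of_pos_right hs0').1 hs
  have hnn : 0 ≤ inner ℝ (grad u z) q - τ * (α * inner ℝ q q) := by
    refine ge_of_tendsto (hgl.tendsto_slope.mono_left hmono) ?_
    filter_upwards [hφpos, self_mem_nhdsWithin, hle'.filter_mono nhdsWithin_le_nhds]
      with s h1 hs0 h2
    have hs0' : (0 : ℝ) < s := hs0
    rw [slope_def_field]
    simp only [Pi.sub_apply, zero_smul, add_zero, rayExt_coe, hφz, huz, mul_zero, Real.exp_zero,
      sub_self, sub_zero]
    exact div_nonneg (h2 h1.le) hs0'.le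
  have : 0 < τ * (α * inner ℝ q q) := by positivity
  linarith

/-- Hopf's lemma at a point `z` of the closure where `v` touches `v'` from above. The domain enters
through the function `φ₀` alone: near `z` the set `{φ₀ > 0}` lies in `Ω`, and there `v' < v`.
The barrier is built on `φ = φ₀ - (1 - ⟨y, z⟩)`, whose set `{φ ≥ 0}` meets `{φ₀ ≤ 0}` near `z` in
the point `z` only, so no interior ball is required. -/
theorem Ambient.inner_grad_sub_pos (K : Ambient) {n : ℕ} {f : (Fin n → ℝ) → ℝ}
    (hf : IsCurvatureFunction f) {Ω : Set (Sph n)} {v v' φ₀ : Sph n → ℝ} {z : Sph n}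
    {c Λ : ℝ} (hc : 0 < c) (hΛ : 0 ≤ Λ)
    (hv : ContMDiffAt (𝓡 n) 𝓘(ℝ, ℝ) 2 v z) (hv' : ContMDiffAt (𝓡 n) 𝓘(ℝ, ℝ) 2 v' z)
    (hconv : K.StrictlyLocallyConvex Ω v) (hconv' : K.StrictlyLocallyConvex Ω v')
    (hrange : v' z ∈ K.range) (heq : v z = v' z)
    (hpde : ∀ᶠ y in 𝓝 z, y ∈ Ω → v' y ≤ v y →
      c ≤ K.curv f v' y ∧ K.curv f v y ≤ K.curv f v' y + Λ * (v y - v' y))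
    (hφ₀ : ContMDiffAt (𝓡 n) 𝓘(ℝ, ℝ) 2 φ₀ z) (hφ₀z : φ₀ z = 0) (hg : grad φ₀ z ≠ 0)
    (hin : ∀ᶠ y in 𝓝 z, 0 < φ₀ y → y ∈ Ω ∧ v' y < v y) :
    0 < inner ℝ (grad (fun y => v y - v' y) z) (grad φ₀ z) := by
  -- the function `φ` under the barrier
  let χ : Sph n → ℝ := fun y => 1 - inner ℝ (y : EuclideanSpace ℝ (Fin (n + 1))) z
  have hχ : ContMDiffAt (𝓡 n) 𝓘(ℝ, ℝ) 2 χ z :=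
    contMDiffAt_const.sub (contMDiff_inner_right (m := 2) (z : EuclideanSpace ℝ (Fin (n + 1))) z)
  have hχz : χ z = 0 := by simp only [χ, inner_coe_self, sub_self]
  have hχpos : ∀ y, y ≠ z → 0 < χ y := fun y hy => sub_pos.2 (inner_lt_one_of_ne hy)
  have hχ0 : grad χ z = 0 := grad_eq_zero_of_isLocalMin (Eventually.of_forall fun y => by
    rcases eq_or_ne y z with rfl | h
    · exact le_rfl
    · rw [hχz]; exact (hχpos y h).le)
  let φ : Sph n → ℝ := fun y => φ₀ y - χ y
  have hφ : ContMDiffAt (𝓡 n) 𝓘(ℝ, ℝ) 2 φ z := hφ₀.sub hχ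
  have hφz : φ z = 0 := by simp only [φ, hφ₀z, hχz, sub_self]
  have hdiff : ∀ {w : Sph n → ℝ}, ContMDiffAt (𝓡 n) 𝓘(ℝ, ℝ) 2 w z →
      DifferentiableAt ℝ (rayExt w) (z : EuclideanSpace ℝ (Fin (n + 1))) := fun hw =>
    (contDiffAt_rayExt (m := 2) hw).differentiableAt (by simp)
  have hgφ : grad φ z = grad φ₀ z := by
    rw [show grad φ z = grad φ₀ z - grad χ z from grad_sub (hdiff hφ₀) (hdiff hχ), hχ0, sub_zero]
  rw [← hgφ] at hg ⊢
  -- uniform bounds near `z`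
  obtain ⟨R₁, hR₁, hb₁⟩ := eventually_jet_bounds hv
  obtain ⟨R₂, hR₂, hb₂⟩ := eventually_jet_bounds hv'
  obtain ⟨R₃, hR₃, hb₃⟩ := eventually_jet_bounds hφ
  set R := R₁ + R₂ + R₃ with hR
  have hg2 : 0 < ‖grad φ z‖ ^ 2 := by have := norm_pos_iff.2 hg; positivity
  have hgrad : ∀ᶠ y in 𝓝 z, ‖grad φ z‖ ^ 2 / 2 < ‖grad φ y‖ ^ 2 := by
    have hcont : ContinuousAt (fun y : Sph n => ‖grad φ y‖ ^ 2) z := by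
      have h1 : ContinuousAt (fderiv ℝ (rayExt φ)) (z : EuclideanSpace ℝ (Fin (n + 1))) :=
        ((contDiffAt_rayExt (m := 2) hφ).fderiv_right (m := 1) (by norm_num)).continuousAt
      have h2 : ContinuousAt (grad φ) z :=
        (LinearIsometryEquiv.continuous _).continuousAt.comp
          (ContinuousAt.comp h1 continuous_subtype_val.continuousAt)
      exact h2.norm.pow 2
    exact hcont.eventually (lt_mem_nhds (half_lt_self hg2))
  obtain ⟨a, b, hzab, hab_nhds, hab⟩ :=
    exists_Icc_mem_subset_of_mem_nhds (K.isOpen_range.mem_nhds hrange)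
  have hvcont : ContinuousAt v z := hv.continuousAt
  have hvcont' : ContinuousAt v' z := hv'.continuousAt
  have hvab : ∀ᶠ y in 𝓝 z, v y ∈ Set.Icc a b := hvcont.eventually (by rw [heq]; exact hab_nhds)
  have hvab' : ∀ᶠ y in 𝓝 z, v' y ∈ Set.Icc a b := hvcont'.eventually hab_nhds
  have hφ1 : ∀ᶠ y in 𝓝 z, φ y < 1 :=
    hφ.continuousAt.eventually (gt_mem_nhds (by rw [hφz]; exact one_pos))
  obtain ⟨δ', hδ', hball⟩ := Metric.eventually_nhds_iff.1
    (((hb₁.and hb₂).and (hb₃.and hgrad)).and ((hvab.and hvab').and (hφ1.and (hpde.and hin))))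
  set δ := δ' / 2 with hδ
  have hδ0 : 0 < δ := half_pos hδ'
  have hnear : ∀ y, dist y z ≤ δ → _ := fun y hy => hball (lt_of_le_of_lt hy (half_lt_self hδ'))
  obtain ⟨α, hα, E₀, hE₀, hbar⟩ := K.exists_barrier_constants hf (R := R)
    (g := ‖grad φ z‖ ^ 2 / 2) (c := c) (a := a) (b := b) (Λ := Λ) (by positivity) (half_pos hg2)
    hc hab hΛ
  have hcontφ : ∀ y, dist y z ≤ δ → ContinuousAt φ y := fun y hy =>
    continuousAt_of_rayExt (hnear y hy).1.2.1.1.continuousAt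
  have hcontw : ∀ y, dist y z ≤ δ → ContinuousAt (fun y => v y - v' y) y := fun y hy =>
    (continuousAt_of_rayExt (hnear y hy).1.1.1.1.continuousAt).sub
      (continuousAt_of_rayExt (hnear y hy).1.1.2.1.continuousAt)
  have hφ₀pos : ∀ y, 0 ≤ φ y → y ≠ z → 0 < φ₀ y := fun y hy hyz => by
    have := hχpos y hyz
    simp only [φ] at hy
    linarith
  -- the compact set on which `v - v'` is compared with the barrier
  let Q : Set (Sph n) := Metric.closedBall z δ ∩ φ ⁻¹' Set.Ici 0
  have hQ : IsCompact Q := by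
    refine (isCompact_closedBall z δ).of_isClosed_subset ?_ Set.inter_subset_left
    exact ContinuousOn.preimage_isClosed_of_isClosed
      (fun y hy => (hcontφ y hy).continuousWithinAt) Metric.isClosed_closedBall isClosed_Ici
  have hSc : IsCompact (Q ∩ Metric.sphere z δ) := hQ.inter_right Metric.isClosed_sphere
  obtain ⟨m₀, hm₀, hSm⟩ : ∃ m₀ > 0, ∀ y ∈ Q ∩ Metric.sphere z δ, m₀ ≤ v y - v' y := by
    rcases (Q ∩ Metric.sphere z δ).eq_empty_or_nonempty with he | hne
    · exact ⟨1, one_pos, by simp [he]⟩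
    obtain ⟨y, hy, hymin⟩ := hSc.exists_isMinOn hne
      (fun y hy => (hcontw y hy.1.1).continuousWithinAt)
    refine ⟨_, ?_, fun x hx => hymin hx⟩
    have hyz : y ≠ z := by
      rintro rfl
      have := hy.2
      simp at this
      linarith
    exact sub_pos.2 ((hnear y hy.1.1).2.2.2.2 (hφ₀pos y hy.1.2 hyz)).2
  set τ := min m₀ E₀ * Real.exp (-α) with hτ
  have hmin0 : 0 < min m₀ E₀ := lt_min hm₀ hE₀
  have hτ0 : 0 < τ := mul_pos hmin0 (Real.exp_pos _)
  have hτle : ∀ y, dist y z ≤ δ → τ * Real.exp (α * φ y) ≤ min m₀ E₀ := by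
    intro y hy
    have h1 : φ y < 1 := (hnear y hy).2.2.1
    rw [hτ, mul_assoc, ← Real.exp_add]
    refine mul_le_of_le_one_right hmin0.le (Real.exp_le_one_iff.2 ?_)
    nlinarith
  have hcompare : ∀ y ∈ Q, 0 ≤ (v y - v' y) - τ * (Real.exp (α * φ y) - 1) := by
    have hzQ : z ∈ Q := ⟨Metric.mem_closedBall_self hδ0.le, by simp [hφz]⟩
    have hcontk : ∀ y, dist y z ≤ δ →
        ContinuousAt (fun y => (v y - v' y) - τ * (Real.exp (α * φ y) - 1)) y := fun y hy =>
      (hcontw y hy).sub (((Real.continuous_exp.continuousAt.comp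
        (continuousAt_const.mul (hcontφ y hy))).sub continuousAt_const).const_mul τ)
    obtain ⟨y, hy, hymin⟩ := hQ.exists_isMinOn ⟨z, hzQ⟩
      (fun y hy => (hcontk y hy.1).continuousWithinAt)
    intro x hx
    refine le_trans ?_ (hymin hx)
    -- a negative minimum is attained inside, where it contradicts the equation
    by_contra hneg
    push Not at hneg
    have hyd : dist y z ≤ δ := hy.1
    have hyφ : 0 ≤ φ y := hy.2
    have hyz : y ≠ z := by
      rintro rfl
      simp [hφz, heq] at hneg
    obtain ⟨⟨⟨⟨hc₁, hg₁, hh₁⟩, hc₂, hg₂, hh₂⟩, ⟨hc₃, hg₃, hh₃⟩, hgy⟩,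
      ⟨hab₁, hab₂⟩, hy1, hyp, hyin⟩ := hnear y hyd
    obtain ⟨hyΩ, hylt⟩ := hyin (hφ₀pos y hyφ hyz)
    have hyφ0 : 0 < φ y := by
      refine lt_of_le_of_ne hyφ fun h0 => ?_
      rw [← h0] at hneg
      simp at hneg
      linarith
    have hydlt : dist y z < δ := by
      refine lt_of_le_of_ne hyd fun h0 => ?_
      have h1 := hSm y ⟨hy, h0⟩
      have h2 := (hτle y hyd).trans (min_le_left _ _)
      linarith
    have hloc : IsLocalMin (fun y => (v y - v' y) - τ * (Real.exp (α * φ y) - 1)) y := by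
      have h1 : ∀ᶠ x in 𝓝 y, dist x z < δ :=
        (continuous_id.dist continuous_const).continuousAt.eventually (gt_mem_nhds hydlt)
      filter_upwards [h1, (hcontφ y hyd).eventually (lt_mem_nhds hyφ0)] with x hx1 hx2
      exact hymin ⟨hx1.le, hx2.le⟩
    obtain ⟨hgr, hhs⟩ := frame_jets_of_isLocalMin hc₁ hc₂ hc₃ hloc
    have hEpos : 0 < τ * Real.exp (α * φ y) := mul_pos hτ0 (Real.exp_pos _)
    have hwE : v y - v' y ≤ τ * Real.exp (α * φ y) := by linarith
    have hfin := hbar (τ * Real.exp (α * φ y)) hEpos ((hτle y hyd).trans (min_le_right _ _))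
      (hessMat v y) (hessMat v' y) (hessMat φ y) (gradVec v y) (gradVec v' y) (gradVec φ y)
      (v y) (v' y) (fun i j => (hh₂ i j).trans (by linarith))
      (fun i j => (hh₃ i j).trans (by linarith)) (fun i => (hg₁ i).trans (by linarith))
      (fun i => (hg₂ i).trans (by linarith)) (fun i => (hg₃ i).trans (by linarith))
      (by rw [gradVec_dotProduct_self (hc₃.differentiableAt (by simp))]; exact hgy.le)
      hab₁ hab₂ hgr (by rw [abs_of_pos (sub_pos.2 hylt)]; exact hwE)
      (hconv y hyΩ).2 (hconv' y hyΩ).2 (hyp hyΩ hylt.le).1 hhs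
    have hup := (hyp hyΩ hylt.le).2
    have h3 := mul_le_mul_of_nonneg_left hwE hΛ
    have h4 : K.curv f v' y + Λ * (τ * Real.exp (α * φ y)) < K.curv f v y := hfin
    linarith
  refine inner_grad_pos_of_barrier_le hτ0 hα (hdiff (hv.sub hv')) (hdiff hφ)
    (by rw [heq, sub_self]) hφz hg ?_
  filter_upwards [Metric.closedBall_mem_nhds z hδ0] with y hy hyφ
  exact sub_nonneg.1 (hcompare y ⟨hy, hyφ⟩)

/-! ### The comparison at the solution -/

/-- Near a point of the closure of `Ω` where `v` touches the subsolution `v'`, the curvatures of the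
two graphs differ by at most a multiple of `v - v'`, and that of `v'` is bounded away from `0`. -/
theorem Ambient.SolvesAux.eventually_curv_le {K : Ambient} {n : ℕ} {f : (Fin n → ℝ) → ℝ}
    {ψ : Sph n → ℝ → ℝ} (hψ : K.IsSmoothPositive ψ) {ε t : ℝ} {Ω : Set (Sph n)}
    {v v' : Sph n → ℝ} (hsol : K.SolvesAux f ψ ε t Ω v' v) (hε : 0 < ε)
    (ht : t ∈ Set.Icc (0 : ℝ) 1) (hsub : ∀ z ∈ Ω, ψ z (v' z) ≤ K.curv f v' z)
    (hsmall : ∀ z ∈ Ω, ε * K.xi (v' z) < K.curv f v' z) {z : Sph n}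
    (hv : ContinuousAt v z) (hv' : ContinuousAt v' z) (hrange : v' z ∈ K.range)
    (heq : v z = v' z) :
    ∃ c > 0, ∃ Λ, 0 ≤ Λ ∧ ∀ᶠ y in 𝓝 z, y ∈ Ω → v' y ≤ v y →
      c ≤ K.curv f v' y ∧ K.curv f v y ≤ K.curv f v' y + Λ * (v y - v' y) := by
  obtain ⟨N, hN, hNz, hev⟩ := exists_smooth_normalization z
  -- `ψ` as a function on an open set of a normed space
  let Ψ : EuclideanSpace ℝ (Fin (n + 1)) × ℝ → ℝ := fun x => ψ (N x.1) x.2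
  have hΨ : ContDiffAt ℝ 1 Ψ ((z : EuclideanSpace ℝ (Fin (n + 1))), v' z) := by
    rw [← contMDiffAt_iff_contDiffAt]
    have h1 : ContMDiffAt ((𝓡 n).prod 𝓘(ℝ, ℝ)) 𝓘(ℝ, ℝ) 1 (fun q : Sph n × ℝ => ψ q.1 q.2)
        (N z, v' z) :=
      (hψ.1.contMDiffAt ((isOpen_univ.prod K.isOpen_range).mem_nhds
        ⟨Set.mem_univ _, hrange⟩)).of_le (by simp)
    have h2 : ContMDiff 𝓘(ℝ, EuclideanSpace ℝ (Fin (n + 1)) × ℝ) ((𝓡 n).prod 𝓘(ℝ, ℝ)) 1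
        fun x : EuclideanSpace ℝ (Fin (n + 1)) × ℝ => (N x.1, x.2) :=
      ((hN.of_le (by simp)).comp contDiff_fst.contMDiff).prodMk contDiff_snd.contMDiff
    exact ContMDiffAt.comp ((z : EuclideanSpace ℝ (Fin (n + 1))), v' z) h1 h2.contMDiffAt
  obtain ⟨L₁, U₁, hU₁, hL₁⟩ := hΨ.exists_lipschitzOnWith
  obtain ⟨L₂, U₂, hU₂, hL₂⟩ := (K.contDiff_xi.contDiffAt (x := v' z)).exists_lipschitzOnWith
  have hval : ContinuousAt ((↑) : Sph n → EuclideanSpace ℝ (Fin (n + 1))) z :=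
    continuous_subtype_val.continuousAt
  have hpv : ContinuousAt (fun y : Sph n => ((y : EuclideanSpace ℝ (Fin (n + 1))), v y)) z :=
    hval.prodMk hv
  have hpv' : ContinuousAt (fun y : Sph n => ((y : EuclideanSpace ℝ (Fin (n + 1))), v' y)) z :=
    hval.prodMk hv'
  have hNy : ∀ᶠ y : Sph n in 𝓝 z, ∀ s, ψ (N y) s = ψ y s := by
    filter_upwards [hval.eventually hev] with y hy s
    have := hy fun x => ψ x s
    rw [← this, rayExt_coe]
  have hψ0 : 0 < ψ z (v' z) := hψ.2 z _ hrange
  refine ⟨ψ z (v' z) / 2, half_pos hψ0, L₁ + ε * L₂, by positivity, ?_⟩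
  have hlow : ∀ᶠ y : Sph n in 𝓝 z, ψ z (v' z) / 2 < Ψ ((y : EuclideanSpace ℝ (Fin (n + 1))), v' y) := by
    have hc : ContinuousAt
        (fun y : Sph n => Ψ ((y : EuclideanSpace ℝ (Fin (n + 1))), v' y)) z :=
      ContinuousAt.comp (g := Ψ) hΨ.continuousAt hpv'
    refine hc.tendsto.eventually_const_lt ?_
    simp only [Ψ, hNz]
    exact half_lt_self hψ0
  filter_upwards [hNy, hlow, hpv.preimage_mem_nhds (heq ▸ hU₁ : U₁ ∈ 𝓝 (_, v z)),
    hpv'.preimage_mem_nhds hU₁, hv.preimage_mem_nhds (heq ▸ hU₂ : U₂ ∈ 𝓝 (v z)),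
    hv'.preimage_mem_nhds hU₂]
    with y hy1 hy2 hy3 hy4 hy5 hy6 hyΩ hle
  have hw : |v y - v' y| = v y - v' y := abs_of_nonneg (sub_nonneg.2 hle)
  have h1 : ψ y (v y) - ψ y (v' y) ≤ L₁ * (v y - v' y) := by
    have h := hL₁.dist_le_mul _ hy3 _ hy4
    rw [Prod.dist_eq, dist_self, max_eq_right dist_nonneg, Real.dist_eq, Real.dist_eq, hw] at h
    simp only [Ψ, hy1] at h
    exact (le_abs_self _).trans h
  have h2 : K.xi (v y) - K.xi (v' y) ≤ L₂ * (v y - v' y) := by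
    have h := hL₂.dist_le_mul _ hy5 _ hy6
    rw [Real.dist_eq, Real.dist_eq, hw] at h
    exact (le_abs_self _).trans h
  simp only [Ψ, hy1] at hy2
  refine ⟨hy2.le.trans (hsub y hyΩ), ?_⟩
  rw [hsol.1 y hyΩ]
  have hL₁0 : (0 : ℝ) ≤ L₁ := L₁.2
  have hL₂0 : (0 : ℝ) ≤ L₂ := L₂.2
  have hw0 : 0 ≤ v y - v' y := sub_nonneg.2 hle
  have ht0 := ht.1
  have ht1 : 0 ≤ 1 - t := sub_nonneg.2 ht.2
  have e1 := mul_le_mul_of_nonneg_left h1 ht0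
  have e2 := mul_le_mul_of_nonneg_left h2 (mul_nonneg ht1 hε.le)
  have e3 := mul_le_mul_of_nonneg_left (hsub y hyΩ) ht0
  have e4 := mul_le_mul_of_nonneg_left (hsmall y hyΩ).le ht1
  have e5 : t * (L₁ * (v y - v' y)) ≤ L₁ * (v y - v' y) :=
    mul_le_of_le_one_left (mul_nonneg hL₁0 hw0) ht.2
  have e6 : (1 - t) * ε * (L₂ * (v y - v' y)) ≤ ε * (L₂ * (v y - v' y)) := by
    rw [mul_assoc]
    exact mul_le_of_le_one_left (by positivity) (by linarith)
  linarith

theorem Ambient.curv_congr (K : Ambient) {n : ℕ} (f : (Fin n → ℝ) → ℝ) {v v' : Sph n → ℝ}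
    {z : Sph n} (h : v =ᶠ[𝓝 z] v') : K.curv f v z = K.curv f v' z := by
  have h1 := rayExt_eventuallyEq h
  have hg : gradVec v z = gradVec v' z := by
    ext i; rw [gradVec_apply, gradVec_apply, h1.fderiv_eq]
  have hh : hessMat v z = hessMat v' z := by
    ext i j
    show fderiv ℝ (fderiv ℝ (rayExt v)) z _ _ = fderiv ℝ (fderiv ℝ (rayExt v')) z _ _
    rw [h1.fderiv.fderiv_eq]
  rw [Ambient.curv, Ambient.curv, hg, hh, h.self_of_nhds]

theorem dist_sq_eq_inner {n : ℕ} (y z : Sph n) :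
    dist y z ^ 2 = 2 - 2 * inner ℝ (y : EuclideanSpace ℝ (Fin (n + 1))) z := by
  rw [Subtype.dist_eq, dist_eq_norm, norm_sub_sq_real, norm_eq_of_mem_sphere, norm_eq_of_mem_sphere]
  ring

/-- The gradient of the linear function `y ↦ ⟨y, X⟩` at `z` is the tangential part of `X`. It is
enough here that it does not vanish when `X` is a point of the sphere other than `z` in the same
hemisphere. -/
theorem grad_inner_ne_zero {n : ℕ} {z x : Sph n} (hne : z ≠ x)
    (hpos : 0 < inner ℝ (z : EuclideanSpace ℝ (Fin (n + 1))) x) (a : ℝ) :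
    grad (fun y : Sph n => inner ℝ (y : EuclideanSpace ℝ (Fin (n + 1))) x - a) z ≠ 0 := by
  set φ : Sph n → ℝ := fun y => inner ℝ (y : EuclideanSpace ℝ (Fin (n + 1))) x - a with hφ
  have hd : DifferentiableAt ℝ (rayExt φ) (z : EuclideanSpace ℝ (Fin (n + 1))) :=
    (contDiffAt_rayExt (m := 2) (((contMDiff_inner_right (m := 2) _).contMDiffAt).sub
      contMDiffAt_const)).differentiableAt (by simp)
  set X : EuclideanSpace ℝ (Fin (n + 1)) := (x : EuclideanSpace ℝ (Fin (n + 1)))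
  set Z : EuclideanSpace ℝ (Fin (n + 1)) := (z : EuclideanSpace ℝ (Fin (n + 1)))
  have hX : ‖X‖ = 1 := norm_eq_of_mem_sphere x
  have hZ : ‖Z‖ = 1 := norm_eq_of_mem_sphere z
  set k := inner ℝ Z X with hk
  have hk1 : k < 1 := inner_lt_one_of_ne hne
  intro h0
  -- the derivative of the extension at `Z` in the direction `X`, computed in two ways
  have hd' : HasFDerivAt (rayExt φ) (fderiv ℝ (rayExt φ) Z) (Z + (0 : ℝ) • X) := by
    simpa using hd.hasFDerivAt
  have h1 := hd'.comp_hasDerivAt (0 : ℝ) (hasDerivAt_line Z X 0)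
  rw [← inner_grad φ z X, h0, inner_zero_left] at h1
  have hnorm : ∀ s : ℝ, ‖Z + s • X‖ = √(1 + 2 * (s * k) + s ^ 2) := by
    intro s
    rw [eq_comm, Real.sqrt_eq_iff_eq_sq (by nlinarith [sq_nonneg (s + k)]) (norm_nonneg _),
      norm_add_sq_real, norm_smul, inner_smul_right, hX, hZ, ← hk, Real.norm_eq_abs, mul_one, sq_abs]
    ring
  have h2 : HasDerivAt (fun s : ℝ => (√(1 + 2 * (s * k) + s ^ 2))⁻¹ * (k + s) - a)
      (1 - k ^ 2) 0 := by
    have e1 : HasDerivAt (fun s : ℝ => 1 + 2 * (s * k) + s ^ 2) (2 * k) 0 := by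
      have := ((((hasDerivAt_id' (0 : ℝ)).mul_const k).const_mul 2).const_add 1).fun_add
        (hasDerivAt_pow 2 (0 : ℝ))
      exact this.congr_deriv (by simp)
    have e2 := (((e1.sqrt (by simp)).inv (by simp)).mul
      ((hasDerivAt_id (0 : ℝ)).const_add k)).sub_const a
    refine e2.congr_deriv ?_
    simp
    ring
  have h3 : (rayExt φ ∘ fun s : ℝ => Z + s • X) =ᶠ[𝓝 0]
      fun s : ℝ => (√(1 + 2 * (s * k) + s ^ 2))⁻¹ * (k + s) - a := by
    refine Eventually.of_forall fun s => ?_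
    have hpos' : 0 < 1 + 2 * (s * k) + s ^ 2 := by nlinarith [sq_nonneg (s + k)]
    have hne0 : Z + s • X ≠ 0 := by
      rw [← norm_pos_iff, hnorm]
      exact Real.sqrt_pos.2 hpos'
    simp only [Function.comp_apply, rayExt, dif_neg hne0, hφ]
    rw [inner_smul_left, hnorm, inner_add_left, inner_smul_left, ← hk, real_inner_self_eq_norm_sq,
      hX]
    simp
  have h4 := h1.unique (h2.congr_of_eventuallyEq h3)
  nlinarith

/-- The strong maximum principle: if Hopf's lemma holds at the interior touching points, then `v > v'`
everywhere in `Ω` or `v = v'` everywhere in `Ω`. Otherwise some touching point would lie on a sphere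
around a point `x` whose interior contains no touching point; this ball is where `⟨y, x⟩` exceeds a
constant, and Hopf's lemma contradicts that the gradient of `v - v'` vanishes at its minimum. -/
theorem IsSmoothDomain.dichotomy {n : ℕ} {Ω : Set (Sph n)} (hΩ : IsSmoothDomain Ω)
    {v v' : Sph n → ℝ} (hv : ∀ z ∈ Ω, ContMDiffAt (𝓡 n) 𝓘(ℝ, ℝ) 2 v z)
    (hv' : ∀ z ∈ Ω, ContMDiffAt (𝓡 n) 𝓘(ℝ, ℝ) 2 v' z) (hge : ∀ z ∈ Ω, v' z ≤ v z)
    (hopf : ∀ z ∈ Ω, v z = v' z → ∀ φ₀ : Sph n → ℝ, ContMDiffAt (𝓡 n) 𝓘(ℝ, ℝ) 2 φ₀ z →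
      φ₀ z = 0 → grad φ₀ z ≠ 0 → (∀ᶠ y in 𝓝 z, 0 < φ₀ y → y ∈ Ω ∧ v' y < v y) →
      0 < inner ℝ (grad (fun y => v y - v' y) z) (grad φ₀ z)) :
    (∀ z ∈ Ω, v' z < v z) ∨ ∀ z ∈ Ω, v z = v' z := by
  have hcont : ∀ z ∈ Ω, ContinuousAt (fun y => v y - v' y) z := fun z hz =>
    (hv z hz).continuousAt.sub (hv' z hz).continuousAt
  set T : Set (Sph n) := {z | z ∈ Ω ∧ v z = v' z}
  set W : Set (Sph n) := {z | z ∈ Ω ∧ v' z < v z}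
  have hWo : IsOpen W := by
    refine isOpen_iff_mem_nhds.2 fun z hz => ?_
    filter_upwards [hΩ.isOpen.mem_nhds hz.1,
      (hcont z hz.1).tendsto.eventually_const_lt (sub_pos.2 hz.2)] with y hy1 hy2
    exact ⟨hy1, sub_pos.1 hy2⟩
  have hTo : IsOpen T := by
    refine isOpen_iff_mem_nhds.2 fun z₁ hz₁ => ?_
    by_contra hnot
    obtain ⟨ρ', hρ', hball'⟩ := Metric.isOpen_iff.1 hΩ.isOpen z₁ hz₁.1
    obtain ⟨ρ, hρ, hρ1, hball⟩ : ∃ ρ > 0, ρ ≤ 1 ∧ Metric.ball z₁ (2 * ρ) ⊆ Ω := by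
      refine ⟨min (ρ' / 2) 1, by positivity, min_le_right _ _,
        (Metric.ball_subset_ball ?_).trans hball'⟩
      linarith [min_le_left (ρ' / 2) 1]
    -- a point `x` near `z₁` where the functions differ, and the touching point nearest to it
    obtain ⟨x, hxz, hxT⟩ : ∃ x, dist x z₁ < ρ ∧ x ∉ T := by
      by_contra hcon
      push Not at hcon
      exact hnot (Filter.mem_of_superset (Metric.ball_mem_nhds z₁ hρ) fun x hx => hcon x hx)
    have hsubΩ : Metric.closedBall x ρ ⊆ Ω := by
      intro y hy
      apply hball
      have h1 : dist y x ≤ ρ := hy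
      have := dist_triangle y x z₁
      simp only [Metric.mem_ball]
      linarith
    have hxΩ : x ∈ Ω := hsubΩ (Metric.mem_closedBall_self hρ.le)
    let Q : Set (Sph n) := Metric.closedBall x ρ ∩ (fun y => v y - v' y) ⁻¹' Set.Iic 0
    have hQ : IsCompact Q := (isCompact_closedBall x ρ).of_isClosed_subset
      (ContinuousOn.preimage_isClosed_of_isClosed
        (fun y hy => (hcont y (hsubΩ hy)).continuousWithinAt) Metric.isClosed_closedBall isClosed_Iic)
      Set.inter_subset_left
    have hz₁Q : z₁ ∈ Q :=
      ⟨by rw [Metric.mem_closedBall, dist_comm]; exact hxz.le, by simp [hz₁.2]⟩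
    obtain ⟨z, hz, hzmin⟩ := hQ.exists_isMinOn ⟨z₁, hz₁Q⟩
      (continuous_id.dist (continuous_const (y := x))).continuousOn
    have hzd : dist z x < ρ := by
      have h1 : dist z x ≤ dist z₁ x := hzmin hz₁Q
      rw [dist_comm z₁ x] at h1
      linarith
    have hzΩ : z ∈ Ω := hsubΩ hz.1
    have hzeq : v z = v' z := le_antisymm (sub_nonpos.1 hz.2) (hge z hzΩ)
    have hzx : z ≠ x := by
      rintro rfl
      exact hxT ⟨hxΩ, hzeq⟩
    have hpos : 0 < inner ℝ (z : EuclideanSpace ℝ (Fin (n + 1))) x := by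
      have h1 := dist_sq_eq_inner z x
      have h2 : dist z x ^ 2 < 1 := by
        have := dist_nonneg (x := z) (y := x)
        nlinarith
      linarith
    have h := hopf z hzΩ hzeq
      (fun y => inner ℝ (y : EuclideanSpace ℝ (Fin (n + 1))) x -
        inner ℝ (z : EuclideanSpace ℝ (Fin (n + 1))) x)
      (((contMDiff_inner_right (m := 2) _).contMDiffAt).sub contMDiffAt_const) (sub_self _)
      (grad_inner_ne_zero hzx hpos _) (Eventually.of_forall fun y hy => by
        have h1 : dist y x < dist z x := by
          have e1 := dist_sq_eq_inner y x
          have e2 := dist_sq_eq_inner z x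
          exact lt_of_pow_lt_pow_left₀ 2 dist_nonneg (by linarith)
        have hyb : y ∈ Metric.closedBall x ρ := (h1.trans hzd).le
        refine ⟨hsubΩ hyb, ?_⟩
        by_contra hle
        have h2 : dist z x ≤ dist y x := hzmin ⟨hyb, sub_nonpos.2 (not_lt.1 hle)⟩
        linarith)
    have hgz : grad (fun y => v y - v' y) z = 0 := by
      refine grad_eq_zero_of_isLocalMin ?_
      filter_upwards [hΩ.isOpen.mem_nhds hzΩ] with y hy
      rw [hzeq, sub_self]
      exact sub_nonneg.2 (hge y hy)
    rw [hgz, inner_zero_left] at h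
    exact lt_irrefl _ h
  by_contra hcon
  push Not at hcon
  obtain ⟨⟨z₁, hz₁, hz₁'⟩, z₂, hz₂, hz₂'⟩ := hcon
  obtain ⟨y, -, hyT, hyW⟩ := hΩ.isConnected.isPreconnected T W hTo hWo
    (fun z hz => (hge z hz).eq_or_lt.imp (fun h => ⟨hz, h.symm⟩) fun h => ⟨hz, h⟩)
    ⟨z₁, hz₁, hz₁, le_antisymm hz₁' (hge z₁ hz₁)⟩
    ⟨z₂, hz₂, hz₂, lt_of_le_of_ne (hge z₂ hz₂) (Ne.symm hz₂')⟩
  exact hyW.2.ne' hyT.2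

end RadialGraph

theorem lemma5p3 (n : ℕ) (hn : 2 ≤ n) (K : Ambient)
    (Ω : Set (Sph n)) (hΩ : IsSmoothDomain Ω)
    (f : (Fin n → ℝ) → ℝ) (hf : IsCurvatureFunction f)
    (ψ : Sph n → ℝ → ℝ) (hψ : K.IsSmoothPositive ψ)
    -- the strictly locally convex subsolution, which is not a solution
    (vsub : Sph n → ℝ) (hsub_reg : IsC2OnClosure Ω vsub)
    (hsub_range : ∀ z ∈ closure Ω, vsub z ∈ K.range)
    (hsub_conv : K.StrictlyLocallyConvex Ω vsub)
    (hsub : ∀ z ∈ Ω, ψ z (vsub z) ≤ K.curv f vsub z)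
    (hsub_not_sol : ¬ ∀ z ∈ Ω, K.curv f vsub z = ψ z (vsub z))
    -- the small constant of the auxiliary problem
    (ε : ℝ) (hε : 0 < ε) (hε_small : ∀ z ∈ Ω, ε * K.xi (vsub z) < K.curv f vsub z)
    (t : ℝ) (ht : t ∈ Set.Icc (0 : ℝ) 1)
    -- the solution
    (v : Sph n → ℝ) (hv_reg : IsC2OnClosure Ω v)
    (hv_conv : K.StrictlyLocallyConvex Ω v)
    (hv_sol : K.SolvesAux f ψ ε t Ω vsub v)
    (hv_ge : ∀ z ∈ Ω, vsub z ≤ v z) :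
    (∀ z ∈ Ω, vsub z < v z) ∧
      ∀ z ∈ frontier Ω, ∀ ν, IsInteriorUnitNormal Ω z ν →
        0 < inner ℝ (grad (fun y => v y - vsub y) z) ν := by
  have hopf : ∀ z ∈ closure Ω, v z = vsub z → ∀ φ₀ : Sph n → ℝ,
      ContMDiffAt (𝓡 n) 𝓘(ℝ, ℝ) 2 φ₀ z → φ₀ z = 0 → grad φ₀ z ≠ 0 →
      (∀ᶠ y in nhds z, 0 < φ₀ y → y ∈ Ω ∧ vsub y < v y) →
      0 < inner ℝ (grad (fun y => v y - vsub y) z) (grad φ₀ z) := by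
    intro z hz heq φ₀ h1 h2 h3 h4
    obtain ⟨c, hc, Λ, hΛ, hpde⟩ := hv_sol.eventually_curv_le hψ hε ht hsub hε_small
      (hv_reg z hz).continuousAt (hsub_reg z hz).continuousAt (hsub_range z hz) heq
    exact K.inner_grad_sub_pos hf hc hΛ (hv_reg z hz) (hsub_reg z hz) hv_conv hsub_conv
      (hsub_range z hz) heq hpde h1 h2 h3 h4
  have hlt : ∀ z ∈ Ω, vsub z < v z := by
    refine (hΩ.dichotomy (fun z hz => hv_reg z (subset_closure hz))
      (fun z hz => hsub_reg z (subset_closure hz)) hv_ge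
      fun z hz => hopf z (subset_closure hz)).resolve_right fun hall => hsub_not_sol ?_
    intro z hz
    have hcurv : K.curv f v z = K.curv f vsub z :=
      K.curv_congr f (Filter.eventually_of_mem (hΩ.isOpen.mem_nhds hz) hall)
    have hs := hv_sol.1 z hz
    rw [hcurv, hall z hz] at hs
    have h1 := hsub z hz
    have h2 := hε_small z hz
    rcases eq_or_lt_of_le ht.2 with rfl | hlt
    · simpa using hs
    -- for `t < 1` the right-hand side averages `ψ` and `ε ξ`, and the curvature exceeds the latter
    · exfalso
      have e1 := mul_le_mul_of_nonneg_left h1 ht.1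
      have e2 := mul_lt_mul_of_pos_left h2 (sub_pos.2 hlt)
      linarith
  refine ⟨hlt, ?_⟩
  rintro z hz ν ⟨d, ⟨hdz, hdg, U, hU, hzU, hdU, hdΩ⟩, rfl⟩
  rw [inner_smul_right]
  refine mul_pos (inv_pos.2 (norm_pos_iff.2 hdg)) ?_
  refine hopf z (frontier_subset_closure hz) (hv_sol.2 z hz) d
    ((hdU.contMDiffAt (hU.mem_nhds hzU)).of_le
      (show ((2 : ℕ∞) : WithTop ℕ∞) ≤ ∞ from WithTop.coe_le_coe.2 le_top)) hdz hdg ?_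
  filter_upwards [hU.mem_nhds hzU] with y hy hdy
  have hyΩ := (hdΩ y hy).2 hdy
  exact ⟨hyΩ, hlt y hyΩ⟩
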